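/- Let $n\ge 1$, let $v_1,\dots,v_p\in\mathbb Z^n$ and $\lambda_1,\dots,\lambda_p\in\mathbb R$ (for example the ray generators of the fan of a toric Fano manifold and the coefficients of an ample toric divisor). Put $\chi_k(x)=\lambda_k+\langle v_k,x\rangle$, $G_{\mathrm{trop}}=\{x\in\mathbb R^n:\chi_k(x)\ge 0\ \forall k\}$, $F_{j,\mathrm{trop}}=\{x\in G_{\mathrm{trop}}:\chi_j(x)=0\}$, and for $t>0$ put $W_\Sigma(z)=1+\sum_{k=1}^p t^{\lambda_k}z^{v_k}$ and $\mathrm{Log}_t(z)=(\log|z_1|,\dots,\log|z_n|)/\log t$ on $(\mathbb C^*)^n$. Fix $j$. Let $U_j''\subset\subset U_j'\subset\subset U_j$ be open subsets of $\mathbb R^n$ such that $U_j''$ meets $F_{j,\mathrm{trop}}$, and such that there are constants $c_j<c_k$ $(k\ne j)$ with $\chi_j<c_j$ and $\chi_k>c_k$ on $U_j$ for all $k\neq j$. For a function $\rho$ on $\mathbb R^n$ put $$W_{\Sigma,j}(z)=W_\Sigma(z)-\rho(\mathrm{Log}_t z)\sum_{k\ne j}t^{\lambda_k}z^{v_k},\qquad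 \beta_{x,\mathrm{amoeba}}=(x+\mathbb R v_j)\cap U_j\cap \mathrm{Log}_t\big(\{z\in(\mathbb C^*)^n: W_{\Sigma,j}(z)=0\}\big).$$ Call $\rho$ an admissible cut-off function (for $t$) if it is smooth with values in $[0,1]$, equal to $1$ on $U_j''$ and to $0$ outside $U_j'$, and constant on $\beta_{x,\mathrm{amoeba}}$ for every $x\in U_j\cap F_{j,\mathrm{trop}}$. Let $\beta\subset G_{\mathrm{trop}}$ be the tropical curve cut out in $G_{\mathrm{trop}}$ by tropical polynomials $f_1,\dots,f_{n-1}$ with integral exponents, and let $e$ be an edge of $\beta$ with direction $v_j$ and with an end $a\in U_j\cap F_{j,\mathrm{trop}}$. Let its dual cell be the Minkowski sum $\sigma_e=\sigma_1+\dots+\sigma_{n-1}$, where the cell $\sigma_k$ dual to $a$ of the subdivision of the Newton polytope of $f_k$ is an integral segment with edge vector $\xi_k\in\mathbb Z^n$, where $\xi_1,\dots,\xi_{n-1}$ are linearly independent and orthogonal to $v_j$. The weight $w(e)=\mathrm{vol}_{\mathrm{int}}(\sigma_e)$ is the volume of $\sigma_e$ normalized by the lattice of integral vectors parallel to $\sigma_e$.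 Let $\gamma\in\mathbb Z^n$ with $\langle\gamma,v_j\rangle=1$. Let $K\subset U_j\cap F_{j,\mathrm{trop}}$ be a set such that for some $\delta>0$ one has $x+rv_j\in U_j$ for all $x\in K$ and $|r|<\delta$ (for example, any compact subset of $U_j\cap F_{j,\mathrm{trop}}$, in particular any single point). Then there is $t_0>0$ such that for every $0<t<t_0$, every admissible cut-off function $\rho$ for $t$, and every $x\in K$ the following hold. (1) For every $\eta\in\mathbb R^{n-1}$ there are a unique $\tau=\tau_x(\eta)\in\mathbb R$ and a unique $\alpha=\alpha_x(\eta)\in\mathbb R/2\pi\mathbb Z$ with $x+\tau v_j\in\beta_{x,\mathrm{amoeba}}$ and $W_{\Sigma,j}\big(\exp(\log t\,(x+\tau v_j)+\sqrt{-1}(\alpha\gamma+\sum_i\eta_i\xi_i))\big)=0$. (2) The singular fiber $SF_{x,e}$, parametrized by $(\theta_0,\eta_a,\eta)\in[0,2\pi]^{n+1}\mapsto(z,u,v)$ with $$z=\exp\Big(\log t\,(x+\tau_x(\eta)v_j)+\sqrt{-1}\big((\alpha_x(\eta)+\eta_a)\gamma+\textstyle\sum_i\eta_i\xi_i\big)\Big),\quad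 u=|W_{\Sigma,j}(z)|^{1/2}e^{\sqrt{-1}\theta_0},\quad v=W_{\Sigma,j}(z)\,|W_{\Sigma,j}(z)|^{-1/2}e^{-\sqrt{-1}\theta_0}$$ (and $v=0$ where $W_{\Sigma,j}(z)=0$), is an $(n+1)$-cycle in $\{(z,u,v)\in(\mathbb C^*)^n\times\mathbb C^2: uv=W_{\Sigma,j}(z)\}$: the parametrization is continuous, has values in this hypersurface, and takes the same values on opposite faces of the cube. (3) The parametrization is differentiable with $u\ne0$ at almost every point of the cube, the pullback of $\Omega=d\log u\wedge d\log z_1\wedge\cdots\wedge d\log z_n$ under it is integrable over the cube, and $$\int_{SF_{x,e}}\Omega=(2\pi\sqrt{-1})^{n+1}w(e),$$ where $SF_{x,e}$ is oriented by $\partial_{\theta_0}\wedge\partial_{\eta_a}\wedge or(\sigma_e)$ and $or(\sigma_e)$ is the orientation for which $v_j\wedge or(\sigma_e)$ is the standard orientation of $\mathbb R^n$. -/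

import Mathlib

open MeasureTheory Set

noncomputable section

namespace TropicalPeriod

/-- An integral vector, regarded as a real vector. -/
def realVec {n : ℕ} (m : Fin n → ℤ) : Fin n → ℝ := fun i => (m i : ℝ)

/-! ### The polytope, its facets and the Laurent polynomial -/

/-- The affine function `χ_k(x) = λ_k + ⟨v_k, x⟩`. -/
def chi {n p : ℕ} (v : Fin p → Fin n → ℤ) (lam : Fin p → ℝ) (k : Fin p) (x : Fin n → ℝ) : ℝ :=
  lam k + ∑ i, (v k i : ℝ) * x i

/-- The polytope `G_trop = {x | χ_k(x) ≥ 0 for all k}`. -/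
def polytope {n p : ℕ} (v : Fin p → Fin n → ℤ) (lam : Fin p → ℝ) : Set (Fin n → ℝ) :=
  {x | ∀ k, 0 ≤ chi v lam k x}

/-- The facet `F_{j,trop}` of `G_trop` dual to `v_j`. -/
def facet {n p : ℕ} (v : Fin p → Fin n → ℤ) (lam : Fin p → ℝ) (j : Fin p) : Set (Fin n → ℝ) :=
  {x | x ∈ polytope v lam ∧ chi v lam j x = 0}

/-- The Laurent monomial `z^m`. -/
def monomial {n : ℕ} (m : Fin n → ℤ) (z : Fin n → ℂ) : ℂ := ∏ i, z i ^ m i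

/-- The Laurent polynomial `W_Σ(z) = 1 + ∑_k t^{λ_k} z^{v_k}`. -/
def W {n p : ℕ} (v : Fin p → Fin n → ℤ) (lam : Fin p → ℝ) (t : ℝ) (z : Fin n → ℂ) : ℂ :=
  1 + ∑ k, ((t ^ lam k : ℝ) : ℂ) * monomial (v k) z

/-- The rescaled logarithm map `Log_t(z) = (log |z_1|, …, log |z_n|) / log t`. -/
def LogT {n : ℕ} (t : ℝ) (z : Fin n → ℂ) : Fin n → ℝ := fun i => Real.log ‖z i‖ / Real.log t

/-- The deformed function
`W_{Σ,j}(z) = W_Σ(z) - ρ(Log_t z) ∑_{k ≠ j} t^{λ_k} z^{v_k}`, for a cut-off function `ρ`. -/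
def Wj {n p : ℕ} (v : Fin p → Fin n → ℤ) (lam : Fin p → ℝ) (j : Fin p) (t : ℝ)
    (ρ : (Fin n → ℝ) → ℝ) (z : Fin n → ℂ) : ℂ :=
  W v lam t z
    - (ρ (LogT t z) : ℂ) *
      ∑ k ∈ Finset.univ.filter (fun k => k ≠ j), ((t ^ lam k : ℝ) : ℂ) * monomial (v k) z

/-- The rescaled amoeba `Log_t({z ∈ (ℂ^*)^n | g(z) = 0})` of a function `g`. -/
def amoeba {n : ℕ} (t : ℝ) (g : (Fin n → ℂ) → ℂ) : Set (Fin n → ℝ) :=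
  LogT t '' {z | (∀ i, z i ≠ 0) ∧ g z = 0}

/-- Open sets `U'' ⊂⊂ U' ⊂⊂ U` that meet the facet `F_{j,trop}`, where on `U` the function `χ_j`
is smaller than all the other `χ_k`, with a gap: there are constants `c_j < c_k` (`k ≠ j`) with
`χ_j < c_j` and `c_k < χ_k` on `U`. -/
structure FacetNeighborhoods {n p : ℕ} (v : Fin p → Fin n → ℤ) (lam : Fin p → ℝ)
    (j : Fin p) where
  U : Set (Fin n → ℝ)
  U' : Set (Fin n → ℝ)
  U'' : Set (Fin n → ℝ)
  isOpen_U : IsOpen U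
  isOpen_U' : IsOpen U'
  isOpen_U'' : IsOpen U''
  compact_U' : IsCompact (closure U')
  compact_U'' : IsCompact (closure U'')
  closure_U'_subset : closure U' ⊆ U
  closure_U''_subset : closure U'' ⊆ U'
  meets_facet : (U'' ∩ facet v lam j).Nonempty
  gap : ∃ c : Fin p → ℝ, (∀ k, k ≠ j → c j < c k) ∧
    ∀ y ∈ U, chi v lam j y < c j ∧ ∀ k, k ≠ j → c k < chi v lam k y

/-- The set `β_{x,amoeba} = (x + ℝ v_j) ∩ U ∩ 𝒜_t(W_{Σ,j})`. -/
def betaAmoeba {n p : ℕ} (v : Fin p → Fin n → ℤ) (lam : Fin p → ℝ) (j : Fin p)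
    (U : Set (Fin n → ℝ)) (t : ℝ) (ρ : (Fin n → ℝ) → ℝ) (x : Fin n → ℝ) : Set (Fin n → ℝ) :=
  {y | ∃ τ : ℝ, y = x + τ • realVec (v j)} ∩ U ∩ amoeba t (Wj v lam j t ρ)

/-- An admissible cut-off function: smooth, with values in `[0, 1]`, equal to `1` on `U''` and to
`0` outside `U'`, and constant on `β_{x,amoeba}` for every `x ∈ U ∩ F_{j,trop}`. -/
structure IsCutoff {n p : ℕ} {v : Fin p → Fin n → ℤ} {lam : Fin p → ℝ} {j : Fin p}
    (N : FacetNeighborhoods v lam j) (t : ℝ) (ρ : (Fin n → ℝ) → ℝ) : Prop where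
  smooth : ContDiff ℝ (⊤ : ℕ∞) ρ
  mem_Icc : ∀ y, ρ y ∈ Icc (0 : ℝ) 1
  eq_one : ∀ y ∈ N.U'', ρ y = 1
  eq_zero : ∀ y, y ∉ N.U' → ρ y = 0
  const_on : ∀ x ∈ N.U ∩ facet v lam j, ∀ y ∈ betaAmoeba v lam j N.U t ρ x,
    ∀ y' ∈ betaAmoeba v lam j N.U t ρ x, ρ y = ρ y'

/-! ### Tropical curves, dual cells and weights -/

/-- A tropical (max-plus) Laurent polynomial `x ↦ max_{m ∈ A} (c_m + ⟨m, x⟩)`. -/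
structure TropPoly (n : ℕ) where
  support : Finset (Fin n → ℤ)
  nonempty : support.Nonempty
  coeff : (Fin n → ℤ) → ℝ

/-- The exponents whose term attains the maximum at `x`. -/
def TropPoly.maximizers {n : ℕ} (f : TropPoly n) (x : Fin n → ℝ) : Set (Fin n → ℤ) :=
  {m | m ∈ f.support ∧ ∀ m' ∈ f.support,
    f.coeff m' + ∑ i, (m' i : ℝ) * x i ≤ f.coeff m + ∑ i, (m i : ℝ) * x i}

/-- The tropical hypersurface: the maximum is attained at least twice. -/
def TropPoly.hypersurface {n : ℕ} (f : TropPoly n) : Set (Fin n → ℝ) :=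
  {x | (f.maximizers x).Nontrivial}

/-- The cell, dual to `x`, of the regular subdivision of the Newton polytope defined by `f`. -/
def TropPoly.dualCell {n : ℕ} (f : TropPoly n) (x : Fin n → ℝ) : Set (Fin n → ℝ) :=
  convexHull ℝ (realVec '' f.maximizers x)

/-- The tropical complete intersection curve of `f_1, …, f_{n-1}`, cut off by `G`
(here `n = d + 1`). -/
def tropicalCurve {d : ℕ} (f : Fin d → TropPoly (d + 1)) (G : Set (Fin (d + 1) → ℝ)) :
    Set (Fin (d + 1) → ℝ) :=
  {x | x ∈ G ∧ ∀ k, x ∈ (f k).hypersurface}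

/-- The mixed cell `σ = σ_1 + ⋯ + σ_{n-1}` dual to the point `x` (a Minkowski sum); it is the cell
dual to the edge `e` when `x` is a point of `e` that is not a vertex of the curve. -/
def mixedCell {d : ℕ} (f : Fin d → TropPoly (d + 1)) (x : Fin (d + 1) → ℝ) :
    Set (Fin (d + 1) → ℝ) :=
  {y | ∃ s : Fin d → Fin (d + 1) → ℝ, (∀ k, s k ∈ (f k).dualCell x) ∧ y = ∑ k, s k}

/-- The integral points of the linear space parallel to the affine span of `S`. -/
def latticeOf {n : ℕ} (S : Set (Fin n → ℝ)) : Submodule ℤ (Fin n → ℤ) where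
  carrier := {m | realVec m ∈ vectorSpan ℝ S}
  add_mem' := by
    intro a b ha hb
    have h : realVec (a + b) = realVec a + realVec b := by
      funext i; simp [realVec]
    simpa only [mem_ofPred_eq, h] using Submodule.add_mem _ ha hb
  zero_mem' := by
    have h : realVec (0 : Fin n → ℤ) = 0 := by funext i; simp [realVec]
    simp only [mem_ofPred_eq, h, Submodule.zero_mem]
  smul_mem' := by
    intro c a ha
    have h : realVec (c • a) = (c : ℝ) • realVec a := by
      funext i; simp [realVec]
    simpa only [mem_ofPred_eq, h] using Submodule.smul_mem _ _ ha

/-- The integral volume `vol_int(S)` of an integral polytope `S` of any dimension: its volume in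
its affine span, measured in coordinates with respect to a `ℤ`-basis of the parallel lattice
(with a point of `S` as origin; neither choice matters). -/
def intVolume {n : ℕ} (S : Set (Fin n → ℝ)) : ℝ :=
  volume.real {y : Fin (Module.finrank ℤ (latticeOf S)) → ℝ |
    Classical.epsilon (fun q : Fin n → ℝ => q ∈ S)
      + ∑ i, y i • realVec (Module.finBasis ℤ (latticeOf S) i : Fin n → ℤ) ∈ S}

/-- The weight `w(e) = vol_int(σ_e)` of the edge of the tropical curve through the
(non-vertex) point `a`. -/
def edgeWeight {d : ℕ} (f : Fin d → TropPoly (d + 1)) (a : Fin (d + 1) → ℝ) : ℝ :=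
  intVolume (mixedCell f a)

/-- The tropical curve of `f_1, …, f_{n-1}`, cut off by `G_trop`, has an edge `e` with end `a` on
`F_{j,trop}`, with direction `v_j` and with dual cell `σ_e = ξ_1 + ⋯ + ξ_{n-1}`: the cells of
`f_1, …, f_{n-1}` dual to `a` are integral segments with linearly independent edge vectors
`ξ_1, …, ξ_{n-1}`, all of them orthogonal to `v_j`. -/
structure IsEdgeEnd {d p : ℕ} (v : Fin p → Fin (d + 1) → ℤ) (lam : Fin p → ℝ) (j : Fin p)
    (f : Fin d → TropPoly (d + 1)) (a : Fin (d + 1) → ℝ) (ξ : Fin d → Fin (d + 1) → ℤ) :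
    Prop where
  mem_curve : a ∈ tropicalCurve f (polytope v lam)
  mem_facet : a ∈ facet v lam j
  cell : ∀ k, ∃ q : Fin (d + 1) → ℤ,
    (f k).dualCell a = segment ℝ (realVec q) (realVec (q + ξ k))
  indep : LinearIndependent ℝ (fun k => realVec (ξ k))
  perp : ∀ k, ∑ i, v j i * ξ k i = 0

/-! ### The singular fiber -/

/-- The ambient space of the points `(z, u, v)`. -/
abbrev Ambient (n : ℕ) : Type := (Fin n → ℂ) × ℂ × ℂ

/-- The hypersurface `{(z, u, v) ∈ (ℂ^*)^n × ℂ^2 | u v = W_{Σ,j}(z)}`. -/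
def simpleModel {n p : ℕ} (v : Fin p → Fin n → ℤ) (lam : Fin p → ℝ) (j : Fin p) (t : ℝ)
    (ρ : (Fin n → ℝ) → ℝ) : Set (Ambient n) :=
  {P | (∀ i, P.1 i ≠ 0) ∧ P.2.1 * P.2.2 = Wj v lam j t ρ P.1}

/-- The point `exp(log t · (x + τ v_j) + √-1 (α γ + ∑_i η_i ξ_i))` of `(ℂ^*)^n`. -/
def zPoint {d : ℕ} (vj γ : Fin (d + 1) → ℤ) (ξ : Fin d → Fin (d + 1) → ℤ) (t : ℝ)
    (x : Fin (d + 1) → ℝ) (τ α : ℝ) (η : Fin d → ℝ) : Fin (d + 1) → ℂ :=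
  fun i => Complex.exp
    (((Real.log t * (x i + τ * (vj i : ℝ)) : ℝ) : ℂ)
      + Complex.I * ((α * (γ i : ℝ) + ∑ k, η k * (ξ k i : ℝ) : ℝ) : ℂ))

/-- `(τ, α)` solves the equation that defines `(τ_x(η), α_x(η))`:
`x + τ v_j ∈ β_{x,amoeba}` and `W_{Σ,j}` vanishes at the point with parameters `τ, α, η`. The class
`α ∈ ℝ/2πℤ` is represented by a number in `[0, 2π)`. -/
def IsSolution {d p : ℕ} (v : Fin p → Fin (d + 1) → ℤ) (lam : Fin p → ℝ) (j : Fin p)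
    (U : Set (Fin (d + 1) → ℝ)) (t : ℝ) (ρ : (Fin (d + 1) → ℝ) → ℝ)
    (γ : Fin (d + 1) → ℤ) (ξ : Fin d → Fin (d + 1) → ℤ) (x : Fin (d + 1) → ℝ)
    (η : Fin d → ℝ) (s : ℝ × ℝ) : Prop :=
  s.2 ∈ Ico 0 (2 * Real.pi) ∧
  x + s.1 • realVec (v j) ∈ betaAmoeba v lam j U t ρ x ∧
  Wj v lam j t ρ (zPoint (v j) γ ξ t x s.1 s.2 η) = 0

/-- The pair `(τ_x(η), α_x(η))`. -/
def solution {d p : ℕ} (v : Fin p → Fin (d + 1) → ℤ) (lam : Fin p → ℝ) (j : Fin p)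
    (U : Set (Fin (d + 1) → ℝ)) (t : ℝ) (ρ : (Fin (d + 1) → ℝ) → ℝ)
    (γ : Fin (d + 1) → ℤ) (ξ : Fin d → Fin (d + 1) → ℤ) (x : Fin (d + 1) → ℝ)
    (η : Fin d → ℝ) : ℝ × ℝ :=
  Classical.epsilon (IsSolution v lam j U t ρ γ ξ x η)

/-- The parametrization `(θ_0, η_a, η_1, …, η_{n-1}) ↦ (z, u, v)` of the singular fiber
`SF_{x,e}`. -/
def singularFiber {d p : ℕ} (v : Fin p → Fin (d + 1) → ℤ) (lam : Fin p → ℝ) (j : Fin p)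
    (U : Set (Fin (d + 1) → ℝ)) (t : ℝ) (ρ : (Fin (d + 1) → ℝ) → ℝ)
    (γ : Fin (d + 1) → ℤ) (ξ : Fin d → Fin (d + 1) → ℤ) (x : Fin (d + 1) → ℝ)
    (s : Fin (d + 2) → ℝ) : Ambient (d + 1) :=
  let θ₀ : ℝ := s 0
  let ηa : ℝ := s 1
  let η : Fin d → ℝ := fun k => s k.succ.succ
  let τα : ℝ × ℝ := solution v lam j U t ρ γ ξ x η
  let z : Fin (d + 1) → ℂ := zPoint (v j) γ ξ t x τα.1 (τα.2 + ηa) η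
  let w : ℂ := Wj v lam j t ρ z
  (z, ((Real.sqrt ‖w‖ : ℝ) : ℂ) * Complex.exp (Complex.I * (θ₀ : ℂ)),
    w / ((Real.sqrt ‖w‖ : ℝ) : ℂ) * Complex.exp (-(Complex.I * (θ₀ : ℂ))))

/-- The parameter cube `[0, 2π]^m`. -/
def cube (m : ℕ) : Set (Fin m → ℝ) := Icc (fun _ => 0) (fun _ => 2 * Real.pi)

/-! ### The form and its integral -/

/-- The form `Ω = d log u ∧ d log z_1 ∧ ⋯ ∧ d log z_n` at the point `P`, evaluated on the tangent
vectors `X_0, …, X_n`. -/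
def Omega {n : ℕ} (P : Ambient n) (X : Fin (n + 1) → Ambient n) : ℂ :=
  Matrix.det (Matrix.of fun r c : Fin (n + 1) =>
    (Fin.cons ((X c).2.1 / P.2.1) (fun i => (X c).1 i / P.1 i) : Fin (n + 1) → ℂ) r)

/-- The coefficient of the pullback `Ψ^* Ω` with respect to `ds_0 ∧ ⋯ ∧ ds_n`. -/
def pullbackOmega {n : ℕ} (Ψ : (Fin (n + 1) → ℝ) → Ambient n) (s : Fin (n + 1) → ℝ) : ℂ :=
  Omega (Ψ s) (fun b => fderiv ℝ Ψ s (Pi.single b 1))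

/-- The sign that compares the parameters `(η_1, …, η_{n-1})` with the orientation of `σ_e`, which
is the one for which `v_j ∧ or(σ_e)` is the standard orientation. -/
def orientationSign {d : ℕ} (vj : Fin (d + 1) → ℤ) (ξ : Fin d → Fin (d + 1) → ℤ) : ℤ :=
  Int.sign (Matrix.det (Matrix.of (Fin.cons vj ξ : Fin (d + 1) → Fin (d + 1) → ℤ)))

/-- The integral of `Ω` over the oriented singular fiber `SF_{x,e}`, the orientation being
`∂/∂θ_0 ∧ ∂/∂η_a ∧ or(σ_e)`. -/
def integralOnSingularFiber {d p : ℕ} (v : Fin p → Fin (d + 1) → ℤ) (lam : Fin p → ℝ)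
    (j : Fin p) (U : Set (Fin (d + 1) → ℝ)) (t : ℝ) (ρ : (Fin (d + 1) → ℝ) → ℝ)
    (γ : Fin (d + 1) → ℤ) (ξ : Fin d → Fin (d + 1) → ℤ) (x : Fin (d + 1) → ℝ) : ℂ :=
  (orientationSign (v j) ξ : ℂ) *
    ∫ s in cube (d + 2), pullbackOmega (singularFiber v lam j U t ρ γ ξ x) s

end TropicalPeriod

end

/-!
Over the torus above a point of `x + ℝ v_j` the dominant term `t^{λ_j} z^{v_j}` equals `exp ω` with
`ω = log t · τ |v_j|² + i α`, because `⟨v_j, x⟩ = -λ_j`, `⟨γ, v_j⟩ = 1` and `ξ_k ⊥ v_j`. All other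
terms tend to `0` with `t`, so for a constant value `r` of the cut-off function the equation
`W_{Σ,j} = 0` is a small perturbation of `1 + exp ω = 0`, whose only root in the strip
`0 ≤ Im ω < 2π` is the nondegenerate root `iπ`. By the implicit function theorem it has exactly one
solution, smooth in `η` and `r` and periodic in `η`. The value `r` that `ρ` takes at its own
solution is a fixed point, found by the intermediate value theorem; since `ρ` is constant on
`β_{x,amoeba}`, the same `r` serves every `η`.

With this `r` the pullback of `Ω` is `i^{n+1} det(γ, ξ) (1 - i log t · ∂_e τ)`, where `∂_e τ` is a
derivative of `τ` in a constant direction. It integrates to `0` by periodicity, which leaves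
`(2π i)^{n+1} det(γ, ξ)`. Since `σ_e` is a translate of the parallelepiped spanned by the `ξ_k` and
`γ` completes a basis of `v_j^⊥ ∩ ℤⁿ` to a basis of `ℤⁿ`, the integral volume of `σ_e` is
`|det(γ, ξ)|`, and the orientation has the sign of `det(v_j, ξ) = |v_j|² det(γ, ξ)`.
-/

noncomputable section

namespace TropicalPeriod

open Filter Topology
open scoped Matrix Pointwise

lemma exists_eventually_zero_iff_of_compact {𝕜 E F G : Type*} [RCLike 𝕜]
    [NormedAddCommGroup E] [NormedSpace 𝕜 E] [CompleteSpace E]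
    [NormedAddCommGroup F] [NormedSpace 𝕜 F] [CompleteSpace F]
    [NormedAddCommGroup G] [NormedSpace 𝕜 G] [CompleteSpace G]
    {f : E × F → G} {x₀ : E} {y₀ : F} {M : Set F} (hf : ContDiff 𝕜 1 f)
    (hinv : (fderiv 𝕜 f (x₀, y₀) ∘L .inr 𝕜 E F).IsInvertible) (hM : IsCompact M)
    (hy₀ : y₀ ∈ interior M) (hzero : ∀ y ∈ M, f (x₀, y) = 0 ↔ y = y₀) :
    ∃ φ : E → F, ∀ᶠ x in 𝓝 x₀, ContDiffAt 𝕜 1 φ x ∧ φ x ∈ interior M ∧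
      ∀ y ∈ M, f (x, y) = 0 ↔ y = φ x := by
  have hfx₀ : ContDiffAt 𝕜 1 f (x₀, y₀) := hf.contDiffAt
  have hf0 : f (x₀, y₀) = 0 := (hzero _ (interior_subset hy₀)).2 rfl
  set φ := hfx₀.implicitFunction one_ne_zero hinv
  have hφ : ContDiffAt 𝕜 1 φ x₀ := hfx₀.contDiffAt_implicitFunction one_ne_zero hinv
  have hφx₀ : φ x₀ = y₀ := hfx₀.implicitFunction_apply_self one_ne_zero hinv
  have hroot : ∀ᶠ x in 𝓝 x₀, f (x, φ x) = 0 :=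
    hf0 ▸ hfx₀.eventually_apply_implicitFunction one_ne_zero hinv
  have hloc : ∀ᶠ P in 𝓝 (x₀, y₀), f P = 0 → φ P.1 = P.2 := by
    filter_upwards [hfx₀.eventually_apply_eq_iff_implicitFunction one_ne_zero hinv] with P hP h0
    exact hP.1 (h0.trans hf0.symm)
  rw [nhds_prod_eq] at hloc
  obtain ⟨P, hP, Q, hQ, hPQ⟩ := eventually_prod_iff.1 hloc
  obtain ⟨V, hVQ, hV, hy₀V⟩ := eventually_nhds_iff.1 hQ
  obtain ⟨S, _, hS, -, hx₀S, hMT, hST⟩ := generalized_tube_lemma (isCompact_singleton (x := x₀))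
    (hM.diff hV) (isOpen_ne_fun hf.continuous continuous_const) <| by
      rintro ⟨x, y⟩ ⟨rfl, hyM, hyV⟩ h0
      exact hyV ((hzero y hyM).1 h0 ▸ hy₀V)
  have hint : ∀ᶠ x in 𝓝 x₀, φ x ∈ interior M :=
    hφ.continuousAt.eventually_mem (isOpen_interior.mem_nhds (hφx₀ ▸ hy₀))
  refine ⟨φ, ?_⟩
  filter_upwards [hφ.eventually (by simp), hint, hroot, hP, hS.mem_nhds (hx₀S rfl)]
    with x hdiff hxM hx0 hxP hxS
  refine ⟨hdiff, hxM, fun y hy => ⟨fun h0 => ?_, fun h => h ▸ hx0⟩⟩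
  have hyV : y ∈ V := by_contra fun hyV => hST (mk_mem_prod hxS (hMT ⟨hy, hyV⟩)) h0
  exact (hPQ hxP (hVQ y hyV) h0).symm

/-- The function `1 + e^ω`, perturbed by real exponentials of `ω` with small complex coefficients
`A k`; the exponents are real-linear, not complex-linear, in `ω`. -/
def perturbedExp {ι : Type*} [Fintype ι] (b g : ι → ℝ) (P : (ι → ℂ) × ℂ) : ℂ :=
  1 + Complex.exp P.2 +
    ∑ k, P.1 k * Complex.exp (((b k * P.2.re : ℝ) : ℂ) + Complex.I * ((g k * P.2.im : ℝ) : ℂ))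

section PerturbedExp

variable {ι : Type*} [Fintype ι] (b g : ι → ℝ)

lemma contDiff_perturbedExp {n : WithTop ℕ∞} : ContDiff ℝ n (perturbedExp b g) := by
  have hre : ContDiff ℝ n fun P : (ι → ℂ) × ℂ => P.2.re :=
    Complex.reCLM.contDiff.comp contDiff_snd
  have him : ContDiff ℝ n fun P : (ι → ℂ) × ℂ => P.2.im :=
    Complex.imCLM.contDiff.comp contDiff_snd
  have hof : ContDiff ℝ n ((↑) : ℝ → ℂ) := Complex.ofRealCLM.contDiff
  unfold perturbedExp
  fun_prop

lemma perturbedExp_zero (ω : ℂ) : perturbedExp b g (0, ω) = 1 + Complex.exp ω := by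
  simp [perturbedExp]

lemma fderiv_perturbedExp_comp_inr_zero (ω : ℂ) :
    fderiv ℝ (perturbedExp b g) (0, ω) ∘L .inr ℝ (ι → ℂ) ℂ =
      (ContinuousLinearMap.toSpanSingleton ℂ (Complex.exp ω)).restrictScalars ℝ := by
  have hinr : HasFDerivAt (fun ω : ℂ => perturbedExp b g (0, ω)) _ ω :=
    ((contDiff_perturbedExp b g).differentiable one_ne_zero (0, ω)).hasFDerivAt.comp ω
      (hasFDerivAt_prodMk_right (𝕜 := ℝ) (0 : ι → ℂ) ω)
  simp_rw [perturbedExp_zero] at hinr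
  exact hinr.unique (((Complex.hasDerivAt_exp ω).const_add 1).hasFDerivAt.restrictScalars ℝ)

end PerturbedExp

/-- A rectangle that contains exactly one root `πi` of `1 + e^ω`, in its interior. -/
def rootBox : Set ℂ := Icc (-1) 1 ×ℂ Icc 0 (2 * Real.pi)

lemma mem_rootBox {ω : ℂ} : ω ∈ rootBox ↔ |ω.re| ≤ 1 ∧ ω.im ∈ Icc 0 (2 * Real.pi) := by
  rw [rootBox, Complex.mem_reProdIm, abs_le, mem_Icc]

lemma isCompact_rootBox : IsCompact rootBox := isCompact_Icc.reProdIm isCompact_Icc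

lemma mem_interior_rootBox {ω : ℂ} :
    ω ∈ interior rootBox ↔ |ω.re| < 1 ∧ ω.im ∈ Ioo 0 (2 * Real.pi) := by
  rw [rootBox, Complex.interior_reProdIm, interior_Icc, interior_Icc, Complex.mem_reProdIm, abs_lt,
    mem_Ioo]

lemma one_add_exp_eq_zero_iff_of_mem_rootBox {ω : ℂ} (hω : ω ∈ rootBox) :
    1 + Complex.exp ω = 0 ↔ ω = Real.pi * Complex.I := by
  rw [add_comm, add_eq_zero_iff_eq_neg]
  refine ⟨fun h => ?_, fun h => by rw [h, Complex.exp_pi_mul_I]⟩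
  obtain ⟨n, hn⟩ := Complex.exp_eq_exp_iff_exists_int.1 (h.trans Complex.exp_pi_mul_I.symm)
  have him : ω.im = Real.pi + n * (2 * Real.pi) := by simpa using congrArg Complex.im hn
  obtain ⟨-, h0, h2⟩ := mem_rootBox.1 hω
  have hn1 : (n : ℝ) < 1 := by nlinarith [Real.pi_pos]
  have hn2 : (-1 : ℝ) < n := by nlinarith [Real.pi_pos]
  norm_cast at hn1 hn2
  obtain rfl : n = 0 := by omega
  simpa using hn

lemma exists_perturbedExp_eq_zero_iff {ι : Type*} [Fintype ι] (b g : ι → ℝ) :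
    ∃ ε > 0, ∃ φ : (ι → ℂ) → ℂ, ∀ A : ι → ℂ, ‖A‖ < ε → ContDiffAt ℝ 1 φ A ∧
      φ A ∈ interior rootBox ∧ ∀ ω ∈ rootBox, perturbedExp b g (A, ω) = 0 ↔ ω = φ A := by
  set ω₀ : ℂ := Real.pi * Complex.I with hω₀
  have hinv : (fderiv ℝ (perturbedExp b g) (0, ω₀) ∘L .inr ℝ (ι → ℂ) ℂ).IsInvertible := by
    refine ⟨ContinuousLinearEquiv.neg ℝ, ?_⟩
    rw [fderiv_perturbedExp_comp_inr_zero, hω₀, Complex.exp_pi_mul_I]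
    ext; simp
  have hint : ω₀ ∈ interior rootBox :=
    mem_interior_rootBox.2 (by simp [hω₀, Real.pi_pos])
  have hzero : ∀ ω ∈ rootBox, perturbedExp b g (0, ω) = 0 ↔ ω = ω₀ := fun ω hω => by
    rw [perturbedExp_zero, one_add_exp_eq_zero_iff_of_mem_rootBox hω]
  obtain ⟨φ, hφ⟩ := exists_eventually_zero_iff_of_compact (x₀ := 0)
    (contDiff_perturbedExp b g) hinv isCompact_rootBox hint hzero
  obtain ⟨ε, hε, h⟩ := Metric.eventually_nhds_iff_ball.1 hφ
  exact ⟨ε, hε, φ, fun A hA => h A (mem_ball_zero_iff.2 hA)⟩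

section Frame

variable {R : Type*} {d : ℕ}

/-- The square matrix with first row `y`, followed by the rows of `B`. -/
def frame (y : Fin (d + 1) → R) (B : Matrix (Fin d) (Fin (d + 1)) R) :
    Matrix (Fin (d + 1)) (Fin (d + 1)) R :=
  Matrix.of (Fin.cons y B.row)

@[simp]
lemma frame_zero (y : Fin (d + 1) → R) (B : Matrix (Fin d) (Fin (d + 1)) R) (i : Fin (d + 1)) :
    frame y B 0 i = y i := rfl

@[simp]
lemma frame_succ (y : Fin (d + 1) → R) (B : Matrix (Fin d) (Fin (d + 1)) R) (k : Fin d)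
    (i : Fin (d + 1)) : frame y B k.succ i = B k i := rfl

variable [CommRing R]

lemma vecMul_frame (c : Fin (d + 1) → R) (y : Fin (d + 1) → R)
    (B : Matrix (Fin d) (Fin (d + 1)) R) :
    c ᵥ* frame y B = c 0 • y + Fin.tail c ᵥ* B := by
  simp only [Matrix.vecMul_eq_sum, Fin.sum_univ_succ]
  rfl

lemma det_frame_map {S : Type*} [CommRing S] (f : R →+* S) (y : Fin (d + 1) → R)
    (B : Matrix (Fin d) (Fin (d + 1)) R) : (frame (f ∘ y) (B.map f)).det = f (frame y B).det := by
  rw [RingHom.map_det]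
  congr 1
  ext r i
  cases r using Fin.cases <;> rfl

lemma det_frame_smul_add_vecMul (b : R) (c : Fin d → R) (y : Fin (d + 1) → R)
    (B : Matrix (Fin d) (Fin (d + 1)) R) :
    (frame (b • y + c ᵥ* B) B).det = b * (frame y B).det := by
  have hrow : frame (b • y + c ᵥ* B) B =
      (frame y B).updateRow 0 (∑ k, (Fin.cons b c : Fin (d + 1) → R) k • frame y B k) := by
    rw [← Matrix.vecMul_eq_sum, vecMul_frame]
    ext r i
    cases r using Fin.cases <;> simp
  rw [hrow, Matrix.det_updateRow_sum, Fin.cons_zero, smul_eq_mul]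

lemma det_frame_smul_vecMulVec_add_mul (b : R) (c : Fin d → R) (C : Matrix (Fin d) (Fin d) R)
    (y : Fin (d + 1) → R) (B : Matrix (Fin d) (Fin (d + 1)) R) :
    (frame (b • y) (Matrix.vecMulVec c y + C * B)).det = b * C.det * (frame y B).det := by
  let Q : Matrix (Fin (d + 1)) (Fin (d + 1)) R :=
    frame (Fin.cons b 0) (Matrix.of fun k => Fin.cons (c k) (C k))
  have hfactor : frame (b • y) (Matrix.vecMulVec c y + C * B) = Q * frame y B := by
    ext r i
    cases r using Fin.cases <;>
      simp [Q, Matrix.mul_apply, Matrix.vecMulVec_apply, Fin.sum_univ_succ]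
  have hQ : Q.det = b * C.det := by
    have hsub : Q.submatrix Fin.succ Fin.succ = C := rfl
    rw [Matrix.det_succ_row_zero, Fin.sum_univ_succ, Fin.succAbove_zero, hsub]
    simp [Q]
  rw [hfactor, Matrix.det_mul, hQ]

lemma det_one_add_vecMulVec {n : Type*} [Fintype n] [DecidableEq n] (a e : n → R) :
    (1 + Matrix.vecMulVec a e).det = 1 + e ⬝ᵥ a := by
  rw [Matrix.vecMulVec_eq Unit, Matrix.det_one_add_replicateCol_mul_replicateRow]

end Frame

section Perp

variable {𝕜 : Type*} [Field 𝕜] {d : ℕ} {w γ : Fin (d + 1) → 𝕜} {ξ : Matrix (Fin d) (Fin (d + 1)) 𝕜}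

lemma isUnit_frame_of_mulVec_eq_zero (hγ : γ ⬝ᵥ w = 1) (hind : LinearIndependent 𝕜 ξ.row)
    (hperp : ξ *ᵥ w = 0) : IsUnit (frame γ ξ) := by
  rw [← Matrix.linearIndependent_rows_iff_isUnit]
  refine linearIndependent_finCons.2 ⟨hind, fun hmem => ?_⟩
  rw [← range_vecMulLinear] at hmem
  obtain ⟨c, rfl⟩ := hmem
  rw [Matrix.vecMulLinear_apply, ← Matrix.dotProduct_mulVec, hperp, dotProduct_zero] at hγ
  exact zero_ne_one hγ

lemma exists_eq_dotProduct_smul_add_vecMul (hγ : γ ⬝ᵥ w = 1) (hind : LinearIndependent 𝕜 ξ.row)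
    (hperp : ξ *ᵥ w = 0) (y : Fin (d + 1) → 𝕜) : ∃ e, y = (y ⬝ᵥ w) • γ + e ᵥ* ξ := by
  obtain ⟨c, hc : c ᵥ* frame γ ξ = y⟩ := Matrix.vecMul_surjective_iff_isUnit.2
    (isUnit_frame_of_mulVec_eq_zero hγ hind hperp) y
  refine ⟨Fin.tail c, ?_⟩
  rw [← hc, vecMul_frame, add_dotProduct, smul_dotProduct, hγ, ← Matrix.dotProduct_mulVec, hperp,
    dotProduct_zero, smul_eq_mul, mul_one, add_zero]

lemma mem_span_range_row_iff_dotProduct_eq_zero (hγ : γ ⬝ᵥ w = 1)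
    (hind : LinearIndependent 𝕜 ξ.row) (hperp : ξ *ᵥ w = 0) {y : Fin (d + 1) → 𝕜} :
    y ∈ Submodule.span 𝕜 (range ξ.row) ↔ y ⬝ᵥ w = 0 := by
  rw [← range_vecMulLinear]
  constructor
  · rintro ⟨c, rfl⟩
    rw [Matrix.vecMulLinear_apply, ← Matrix.dotProduct_mulVec, hperp, dotProduct_zero]
  · intro hy
    obtain ⟨e, he⟩ := exists_eq_dotProduct_smul_add_vecMul hγ hind hperp y
    exact ⟨e, by rw [Matrix.vecMulLinear_apply, he, hy, zero_smul, zero_add]⟩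

end Perp

section RealVec

variable {n : ℕ}

lemma realVec_add (a b : Fin n → ℤ) : realVec (a + b) = realVec a + realVec b := by
  ext i; simp [realVec]

lemma realVec_dotProduct (a b : Fin n → ℤ) : realVec a ⬝ᵥ realVec b = ((a ⬝ᵥ b : ℤ) : ℝ) := by
  simp [realVec, dotProduct]

/-- The real matrix with the entries of an integral matrix. -/
def realMat {m n : ℕ} (B : Matrix (Fin m) (Fin n) ℤ) : Matrix (Fin m) (Fin n) ℝ :=
  B.map (Int.castRingHom ℝ)

lemma det_realMat (B : Matrix (Fin n) (Fin n) ℤ) : (realMat B).det = (B.det : ℝ) :=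
  ((Int.castRingHom ℝ).map_det B).symm

lemma det_frame_realVec_realMat {d : ℕ} (y : Fin (d + 1) → ℤ) (B : Matrix (Fin d) (Fin (d + 1)) ℤ) :
    (frame (realVec y) (realMat B)).det = ((frame y B).det : ℝ) :=
  det_frame_map (Int.castRingHom ℝ) y B

lemma realMat_mulVec_realVec {m : ℕ} (B : Matrix (Fin m) (Fin n) ℤ) (w : Fin n → ℤ) :
    realMat B *ᵥ realVec w = realVec (B *ᵥ w) :=
  funext fun k => realVec_dotProduct (B k) w

end RealVec

section Parallelepiped

variable {ι E : Type*} [Fintype ι]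

lemma zero_mem_parallelepiped [AddCommGroup E] [Module ℝ E] (v : ι → E) :
    (0 : E) ∈ parallelepiped v :=
  (mem_parallelepiped_iff v 0).2 ⟨0, by simp, by simp⟩

lemma vectorSpan_parallelepiped [AddCommGroup E] [Module ℝ E] (v : ι → E) :
    vectorSpan ℝ (parallelepiped v) = Submodule.span ℝ (range v) := by
  classical
  rw [vectorSpan_eq_span_vsub_set_right ℝ (zero_mem_parallelepiped v)]
  simp only [vsub_eq_sub, sub_zero, image_id']
  refine le_antisymm (Submodule.span_le.2 ?_) (Submodule.span_mono ?_)
  · rintro _ ⟨c, -, rfl⟩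
    exact Submodule.sum_mem _ fun i _ =>
      Submodule.smul_mem _ _ (Submodule.subset_span (mem_range_self i))
  · rintro _ ⟨k, rfl⟩
    refine ⟨Pi.single k 1, ⟨Pi.single_nonneg.2 zero_le_one, ?_⟩, by simp [Pi.single_apply]⟩
    exact fun i => (Pi.single_apply k (1 : ℝ) i).trans_le (by split_ifs <;> simp)

lemma volume_parallelepiped [DecidableEq ι] (v : ι → ι → ℝ) :
    volume (parallelepiped v) = ENNReal.ofReal |(Matrix.of v).det| := by
  have h := Measure.addHaar_parallelepiped (Pi.basisFun ℝ ι) v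
  rwa [Module.Basis.addHaar_def, Module.Basis.parallelepiped_basisFun, addHaarMeasure_eq_volume_pi,
    Pi.basisFun_det] at h

lemma volume_preimage_vadd_parallelepiped [DecidableEq ι] [AddCommGroup E] [Module ℝ E]
    {Λ : (ι → ℝ) →ₗ[ℝ] E} (hΛ : Function.Injective Λ) (M : ι → ι → ℝ) {q q₀ : E}
    (hq₀ : q₀ ∈ q +ᵥ parallelepiped (Λ ∘ M)) :
    volume.real {y | q₀ + Λ y ∈ q +ᵥ parallelepiped (Λ ∘ M)} = |(Matrix.of M).det| := by
  rw [← image_parallelepiped] at hq₀ ⊢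
  obtain ⟨_, ⟨c₀, -, rfl⟩, rfl⟩ := hq₀
  have hset : {y | (q +ᵥ Λ c₀) + Λ y ∈ q +ᵥ Λ '' parallelepiped M} =
      (fun y => c₀ + y) ⁻¹' parallelepiped M := by
    ext y
    rw [mem_ofPred_eq, mem_preimage, ← hΛ.mem_set_image, map_add, vadd_eq_add, add_assoc,
      ← vadd_eq_add, vadd_mem_vadd_set_iff]
  rw [hset, Measure.real, measure_preimage_add, volume_parallelepiped,
    ENNReal.toReal_ofReal (abs_nonneg _)]

end Parallelepiped

lemma exists_basis_eq_cons {R M : Type*} [CommRing R] [AddCommGroup M] [Module R M]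
    {φ : M →ₗ[R] R} {γ : M} (hγ : φ γ = 1) {L : Submodule R M} (hL : ∀ m, m ∈ L ↔ φ m = 0) {r : ℕ}
    (B : Module.Basis (Fin r) R L) :
    ∃ b : Module.Basis (Fin (r + 1)) R M, ⇑b = Fin.cons γ ((↑) ∘ B) := by
  refine ⟨Module.Basis.mkFinCons γ B (fun c x hx h0 => ?_) (fun z => ⟨-φ z, ?_⟩),
    Module.Basis.coe_mkFinCons _ _ _ _⟩
  · simpa [hγ, (hL x).1 hx] using congrArg φ h0
  · simp [hL, hγ]

section IntVolume

variable {d : ℕ}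

lemma mixedCell_eq_sum (f : Fin d → TropPoly (d + 1)) (a : Fin (d + 1) → ℝ) :
    mixedCell f a = ∑ k, (f k).dualCell a := by
  ext y
  simp only [mixedCell, mem_ofPred_eq, mem_fintype_sum, exists_prop, eq_comm]

lemma mixedCell_eq_vadd_parallelepiped {f : Fin d → TropPoly (d + 1)} {a : Fin (d + 1) → ℝ}
    {q ξ : Fin d → Fin (d + 1) → ℤ}
    (h : ∀ k, (f k).dualCell a = segment ℝ (realVec (q k)) (realVec (q k + ξ k))) :
    mixedCell f a = (∑ k, realVec (q k)) +ᵥ parallelepiped fun k => realVec (ξ k) := by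
  have hcell : ∀ k, (f k).dualCell a = {realVec (q k)} + segment ℝ 0 (realVec (ξ k)) := fun k => by
    rw [h, realVec_add, singleton_add, segment_translate_image, add_zero]
  simp only [mixedCell_eq_sum, hcell, Finset.sum_add_distrib, finsetSum_singleton,
    parallelepiped_eq_sum_segment, ← singleton_vadd, vadd_eq_add]

variable {w γ : Fin (d + 1) → ℤ} {ξ : Matrix (Fin d) (Fin (d + 1)) ℤ}

lemma realVec_dotProduct_eq_one (hγ : γ ⬝ᵥ w = 1) : realVec γ ⬝ᵥ realVec w = 1 := by
  rw [realVec_dotProduct, hγ, Int.cast_one]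

lemma dotProduct_self_pos_of_dotProduct_eq_one (hγ : γ ⬝ᵥ w = 1) : 0 < w ⬝ᵥ w := by
  refine lt_of_le_of_ne (Fintype.sum_nonneg fun i => mul_self_nonneg (w i)) fun h => ?_
  rw [dotProduct_self_eq_zero.1 h.symm, dotProduct_zero] at hγ
  exact zero_ne_one hγ

lemma realMat_mulVec_realVec_eq_zero (hperp : ξ *ᵥ w = 0) : realMat ξ *ᵥ realVec w = 0 := by
  rw [realMat_mulVec_realVec, hperp]
  exact funext fun _ => Int.cast_zero

lemma exists_eq_dotProduct_smul_add_vecMul_realMat (hγ : γ ⬝ᵥ w = 1)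
    (hind : LinearIndependent ℝ (realMat ξ).row) (hperp : ξ *ᵥ w = 0) (y : Fin (d + 1) → ℤ) :
    ∃ e, realVec y = ((y ⬝ᵥ w : ℤ) : ℝ) • realVec γ + e ᵥ* realMat ξ := by
  rw [← realVec_dotProduct]
  exact exists_eq_dotProduct_smul_add_vecMul (realVec_dotProduct_eq_one hγ) hind
    (realMat_mulVec_realVec_eq_zero hperp) _

lemma mem_latticeOf_vadd_parallelepiped (hγ : γ ⬝ᵥ w = 1)
    (hind : LinearIndependent ℝ (realMat ξ).row) (hperp : ξ *ᵥ w = 0) (q : Fin (d + 1) → ℝ)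
    (m : Fin (d + 1) → ℤ) :
    m ∈ latticeOf (q +ᵥ parallelepiped (realMat ξ).row) ↔ m ⬝ᵥ w = 0 := by
  change realVec m ∈ vectorSpan ℝ _ ↔ _
  rw [vectorSpan_vadd, vectorSpan_parallelepiped,
    mem_span_range_row_iff_dotProduct_eq_zero (realVec_dotProduct_eq_one hγ) hind
      (realMat_mulVec_realVec_eq_zero hperp), realVec_dotProduct, Int.cast_eq_zero]

lemma volume_preimage_vadd_parallelepiped_realMat {B : Matrix (Fin d) (Fin (d + 1)) ℤ}
    (hB : IsUnit (frame γ B).det) {M : Matrix (Fin d) (Fin d) ℤ} (hM : ξ = M * B)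
    {q q₀ : Fin (d + 1) → ℝ} (hq₀ : q₀ ∈ q +ᵥ parallelepiped (realMat ξ).row) :
    volume.real {y : Fin d → ℝ | q₀ + ∑ i, y i • realVec (B i) ∈
      q +ᵥ parallelepiped (realMat ξ).row} = |((frame γ ξ).det : ℝ)| := by
  subst hM
  have hind : LinearIndependent ℝ (realMat B).row := by
    have hframe : LinearIndependent ℝ (frame (realVec γ) (realMat B)).row := by
      rw [Matrix.linearIndependent_rows_iff_isUnit, Matrix.isUnit_iff_isUnit_det,
        det_frame_realVec_realMat]
      exact hB.map (Int.castRingHom ℝ)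
    exact hframe.comp Fin.succ (Fin.succ_injective d)
  have hcomb : (realMat (M * B)).row =
      Fintype.linearCombination ℝ (realMat B).row ∘ (realMat M).row := by
    ext k i
    simp [realMat, Matrix.mul_apply, Fintype.linearCombination_apply, Finset.sum_apply]
  have hdet : |((frame γ (M * B)).det : ℝ)| = |(realMat M).det| := by
    have h := det_frame_smul_vecMulVec_add_mul 1 0 M γ B
    rw [one_smul, Matrix.zero_vecMulVec, zero_add, one_mul] at h
    rw [h, det_realMat, Int.cast_mul, abs_mul, ← Int.cast_abs (a := (frame γ B).det),
      Int.isUnit_iff_abs_eq.1 hB, Int.cast_one, mul_one]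
  rw [hdet]
  rw [hcomb] at hq₀ ⊢
  exact volume_preimage_vadd_parallelepiped
    hind.fintypeLinearCombination_injective _ hq₀

lemma intVolume_vadd_parallelepiped (hγ : γ ⬝ᵥ w = 1)
    (hind : LinearIndependent ℝ (realMat ξ).row) (hperp : ξ *ᵥ w = 0) (q : Fin (d + 1) → ℝ) :
    intVolume (q +ᵥ parallelepiped (realMat ξ).row) = |((frame γ ξ).det : ℝ)| := by
  have hlat := mem_latticeOf_vadd_parallelepiped hγ hind hperp q
  have hq₀ : Classical.epsilon (· ∈ q +ᵥ parallelepiped (realMat ξ).row) ∈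
      q +ᵥ parallelepiped (realMat ξ).row :=
    Classical.epsilon_spec (p := (· ∈ q +ᵥ parallelepiped (realMat ξ).row))
      (Nonempty.vadd_set ⟨_, zero_mem_parallelepiped _⟩)
  unfold intVolume
  generalize Classical.epsilon (· ∈ q +ᵥ parallelepiped (realMat ξ).row) = q₀ at hq₀ ⊢
  generalize Module.finBasis ℤ (latticeOf (q +ᵥ parallelepiped (realMat ξ).row)) = B
  generalize Module.finrank ℤ (latticeOf (q +ᵥ parallelepiped (realMat ξ).row)) = r at B
  obtain ⟨b, hb⟩ := exists_basis_eq_cons (φ := Fintype.linearCombination ℤ w) hγ hlat B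
  obtain rfl : r = d := by
    simpa using (Module.finrank_eq_card_basis b).symm
  have hunit : IsUnit (frame γ (Matrix.of fun i => (B i : Fin (r + 1) → ℤ))).det := by
    have h := (Pi.basisFun ℤ (Fin (r + 1))).isUnit_det b
    rwa [Pi.basisFun_det, hb] at h
  obtain ⟨M, hM⟩ : ∃ M : Matrix (Fin r) (Fin r) ℤ,
      ξ = M * Matrix.of fun i => (B i : Fin (r + 1) → ℤ) := by
    have hξ := fun k => (hlat (ξ k)).2 (congrFun hperp k)
    refine ⟨Matrix.of fun k => B.repr ⟨ξ k, hξ k⟩, ?_⟩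
    ext k i
    have h := congrArg (fun m : latticeOf _ => (m : Fin (r + 1) → ℤ) i) (B.sum_repr ⟨ξ k, hξ k⟩)
    simp only [Submodule.coe_sum, Submodule.coe_smul, Finset.sum_apply, Pi.smul_apply] at h
    exact h.symm
  exact volume_preimage_vadd_parallelepiped_realMat hunit hM hq₀

lemma edgeWeight_eq_abs_det {f : Fin d → TropPoly (d + 1)} {a : Fin (d + 1) → ℝ}
    (hcell : ∀ k, ∃ q : Fin (d + 1) → ℤ,
      (f k).dualCell a = segment ℝ (realVec q) (realVec (q + ξ k)))
    (hγ : γ ⬝ᵥ w = 1) (hind : LinearIndependent ℝ (realMat ξ).row) (hperp : ξ *ᵥ w = 0) :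
    edgeWeight f a = |((frame γ ξ).det : ℝ)| := by
  choose q hq using hcell
  rw [edgeWeight, mixedCell_eq_vadd_parallelepiped hq]
  exact intVolume_vadd_parallelepiped hγ hind hperp _

lemma det_frame_eq_dotProduct_mul_det_frame (hγ : γ ⬝ᵥ w = 1)
    (hind : LinearIndependent ℝ (realMat ξ).row) (hperp : ξ *ᵥ w = 0) :
    (frame w ξ).det = (w ⬝ᵥ w) * (frame γ ξ).det := by
  obtain ⟨e, he⟩ := exists_eq_dotProduct_smul_add_vecMul_realMat hγ hind hperp w
  have h := det_frame_smul_add_vecMul ((w ⬝ᵥ w : ℤ) : ℝ) e (realVec γ) (realMat ξ)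
  rw [← he, det_frame_realVec_realMat, det_frame_realVec_realMat] at h
  exact_mod_cast h

lemma orientationSign_mul_det_frame (hγ : γ ⬝ᵥ w = 1)
    (hind : LinearIndependent ℝ (realMat ξ).row) (hperp : ξ *ᵥ w = 0) :
    orientationSign w ξ * (frame γ ξ).det = |(frame γ ξ).det| := by
  have hw : 0 < w ⬝ᵥ w := dotProduct_self_pos_of_dotProduct_eq_one hγ
  change Int.sign (frame w ξ).det * _ = _
  rw [det_frame_eq_dotProduct_mul_det_frame hγ hind hperp, Int.sign_mul, Int.sign_eq_one_of_pos hw,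
    one_mul, Int.sign_mul_self_eq_abs]

end IntVolume

/-! ### Integrals over period cubes -/

section Divergence

variable {n : ℕ} {E : Type*} [NormedAddCommGroup E] [NormedSpace ℝ E]

lemma setIntegral_Icc_fderiv_eq_zero_of_periodic {a b : Fin (n + 1) → ℝ} (hab : a ≤ b)
    {f : (Fin (n + 1) → ℝ) → E} (hf : ContDiff ℝ 1 f)
    (hper : ∀ s i, f (Function.update s i (a i)) = f (Function.update s i (b i)))
    (u : Fin (n + 1) → ℝ) : ∫ s in Icc a b, fderiv ℝ f s u = 0 := by
  have hsum : ∀ s, ∑ i, (u i • fderiv ℝ f s) (Pi.single i 1) = fderiv ℝ f s u := fun s => by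
    conv_rhs => rw [pi_eq_sum_univ' u, map_sum]
    simp only [smul_apply, map_smul]
  have hface : ∀ (i : Fin (n + 1)) (y : Fin n → ℝ),
      f (i.insertNth (b i) y) = f (i.insertNth (a i) y) := fun i y => by
    simpa only [Fin.update_insertNth] using (hper (i.insertNth (a i) y) i).symm
  have hdiv := integral_divergence_of_hasFDerivAt_off_countable' a b hab
    (fun i s => u i • f s) (fun i s => u i • fderiv ℝ f s) ∅ countable_empty
    (fun i => (hf.continuous.const_smul (u i)).continuousOn)
    (fun s _ i => ((hf.differentiable one_ne_zero s).hasFDerivAt).const_smul (u i))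
  simp_rw [hsum] at hdiv
  rw [hdiv (hf.continuous_fderiv_apply one_ne_zero |>.comp
    (continuous_id.prodMk continuous_const)).integrableOn_Icc]
  simp only [hface, sub_self, Finset.sum_const_zero]

end Divergence

lemma volume_real_cube (m : ℕ) : volume.real (cube m) = (2 * Real.pi) ^ m := by
  rw [cube, measureReal_def, Real.volume_Icc_pi_toReal fun _ => Real.two_pi_pos.le]
  simp only [sub_zero, Finset.prod_const, Finset.card_univ, Fintype.card_fin]

lemma integrableOn_cube_of_continuous {m : ℕ} {h : (Fin m → ℝ) → ℂ} (hh : Continuous h) :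
    IntegrableOn h (cube m) :=
  hh.continuousOn.integrableOn_compact isCompact_Icc

lemma ae_restrict_cube_of_forall_mem_Ioo {m : ℕ} {P : (Fin m → ℝ) → Prop}
    (h : ∀ s, (∀ b, s b ∈ Ioo 0 (2 * Real.pi)) → P s) :
    ∀ᵐ s ∂volume.restrict (cube m), P s := by
  have hae := Measure.univ_pi_Ioo_ae_eq_Icc (μ := fun _ : Fin m => (volume : Measure ℝ))
    (f := fun _ => 0) (g := fun _ => 2 * Real.pi)
  rw [← volume_pi] at hae
  rw [cube, ← Measure.restrict_congr_set hae]
  exact ae_restrict_of_forall_mem (MeasurableSet.univ_pi fun _ => measurableSet_Ioo)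
    fun s hs => h s fun b => hs b (mem_univ b)

/-- The projection `(θ₀, η_a, η) ↦ η` of the parameters of the singular fiber. -/
def etaProj (d : ℕ) : (Fin (d + 2) → ℝ) →L[ℝ] (Fin d → ℝ) :=
  ContinuousLinearMap.pi fun k => ContinuousLinearMap.proj k.succ.succ

@[simp]
lemma etaProj_apply {d : ℕ} (s : Fin (d + 2) → ℝ) (k : Fin d) :
    etaProj d s k = s k.succ.succ := rfl

@[simp]
lemma etaProj_cons_cons {d : ℕ} (r r' : ℝ) (η : Fin d → ℝ) :
    etaProj d (Fin.cons r (Fin.cons r' η) : Fin (d + 2) → ℝ) = η := by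
  ext k
  simp only [etaProj_apply, Fin.cons_succ]

@[simp]
lemma etaProj_update_zero {d : ℕ} (s : Fin (d + 2) → ℝ) (r : ℝ) :
    etaProj d (Function.update s 0 r) = etaProj d s := by
  ext k
  simp only [etaProj_apply, Function.update_of_ne (Fin.succ_ne_zero _)]

@[simp]
lemma etaProj_update_one {d : ℕ} (s : Fin (d + 2) → ℝ) (r : ℝ) :
    etaProj d (Function.update s 1 r) = etaProj d s := by
  ext k
  simp only [etaProj_apply, Function.update_of_ne (Fin.succ_succ_ne_one k)]

@[simp]
lemma etaProj_update_succ_succ {d : ℕ} (s : Fin (d + 2) → ℝ) (k : Fin d) (r : ℝ) :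
    etaProj d (Function.update s k.succ.succ r) = Function.update (etaProj d s) k r := by
  ext l
  simp only [etaProj_apply, Function.update_apply, Fin.succ_inj]

@[simp]
lemma etaProj_single_one {d : ℕ} : etaProj d (Pi.single 1 1) = 0 :=
  (etaProj_update_one 0 1).trans (map_zero _)

@[simp]
lemma etaProj_single_succ_succ {d : ℕ} (k : Fin d) :
    etaProj d (Pi.single k.succ.succ 1) = Pi.single k 1 :=
  etaProj_update_succ_succ 0 k 1

lemma setIntegral_cube_fderiv_etaProj_eq_zero {d : ℕ} {τ : (Fin d → ℝ) → ℝ}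
    (hτ : ContDiff ℝ 1 τ)
    (hper : ∀ η k, τ (Function.update η k 0) = τ (Function.update η k (2 * Real.pi)))
    (e : Fin d → ℝ) : ∫ s in cube (d + 2), fderiv ℝ τ (etaProj d s) e = 0 := by
  have hfderiv : ∀ s, fderiv ℝ (τ ∘ etaProj d) s (Fin.cons 0 (Fin.cons 0 e)) =
      fderiv ℝ τ (etaProj d s) e := fun s => by
    rw [fderiv_comp s (hτ.differentiable one_ne_zero _) (etaProj d).differentiableAt,
      ContinuousLinearMap.fderiv, ContinuousLinearMap.comp_apply, etaProj_cons_cons]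
  simp_rw [← hfderiv]
  refine setIntegral_Icc_fderiv_eq_zero_of_periodic (fun _ => Real.two_pi_pos.le)
    (hτ.comp (etaProj d).contDiff) (fun s b => ?_) _
  refine Fin.cases ?_ (Fin.cases ?_ fun k => ?_) b
  · simp only [Function.comp_apply, etaProj_update_zero]
  · simp only [Function.comp_apply, Fin.succ_zero_eq_one, etaProj_update_one]
  · simp only [Function.comp_apply, etaProj_update_succ_succ, hper]

/-! ### Torus fibrations of conic bundles -/

/-- The point `(|w|^{1/2} e^{iθ}, w |w|^{-1/2} e^{-iθ})` of the conic `uv = w`, the point `(0, 0)`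
when `w = 0`; for fixed `w` these points form the circle `|u| = |v|`. -/
def hyperbolaPoint (w : ℂ) (θ : ℝ) : ℂ × ℂ :=
  (((Real.sqrt ‖w‖ : ℝ) : ℂ) * Complex.exp (Complex.I * (θ : ℂ)),
    w / ((Real.sqrt ‖w‖ : ℝ) : ℂ) * Complex.exp (-(Complex.I * (θ : ℂ))))

section HyperbolaPoint

variable {w : ℂ} {θ : ℝ}

lemma ofReal_sqrt_norm_ne_zero (hw : w ≠ 0) : ((Real.sqrt ‖w‖ : ℝ) : ℂ) ≠ 0 :=
  Complex.ofReal_ne_zero.2 (Real.sqrt_ne_zero'.2 (norm_pos_iff.2 hw))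

lemma hyperbolaPoint_fst_ne_zero (hw : w ≠ 0) : (hyperbolaPoint w θ).1 ≠ 0 :=
  mul_ne_zero (ofReal_sqrt_norm_ne_zero hw) (Complex.exp_ne_zero _)

lemma hyperbolaPoint_fst_mul_snd : (hyperbolaPoint w θ).1 * (hyperbolaPoint w θ).2 = w := by
  rw [hyperbolaPoint, mul_mul_mul_comm, ← Complex.exp_add, add_neg_cancel, Complex.exp_zero,
    mul_one]
  refine mul_div_cancel_of_imp' fun h => ?_
  by_contra hw
  exact ofReal_sqrt_norm_ne_zero hw h

lemma hyperbolaPoint_two_pi (w : ℂ) : hyperbolaPoint w (2 * Real.pi) = hyperbolaPoint w 0 := by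
  have hexp : Complex.exp (Complex.I * ((2 * Real.pi : ℝ) : ℂ)) = 1 := by
    rw [Complex.ofReal_mul, Complex.ofReal_ofNat, mul_comm, Complex.exp_two_pi_mul_I]
  simp only [hyperbolaPoint, Complex.exp_neg, hexp, Complex.ofReal_zero, mul_zero,
    Complex.exp_zero]

lemma continuous_div_sqrt_norm : Continuous fun w : ℂ => w / ((Real.sqrt ‖w‖ : ℝ) : ℂ) := by
  refine continuous_iff_continuousAt.2 fun w => ?_
  obtain rfl | hw := eq_or_ne w 0
  · rw [ContinuousAt, zero_div]
    have hsqrt : Tendsto (fun w : ℂ => Real.sqrt ‖w‖) (𝓝 0) (𝓝 0) := by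
      simpa only [Function.comp_def, norm_zero, Real.sqrt_zero] using
        (Real.continuous_sqrt.comp (continuous_norm (E := ℂ))).tendsto 0
    refine squeeze_zero_norm (fun w => ?_) hsqrt
    rw [norm_div, Complex.norm_real, Real.norm_of_nonneg (Real.sqrt_nonneg _), Real.div_sqrt]
  · exact continuousAt_id.div (by fun_prop) (ofReal_sqrt_norm_ne_zero hw)

lemma continuous_hyperbolaPoint : Continuous fun P : ℂ × ℝ => hyperbolaPoint P.1 P.2 := by
  refine .prodMk (by fun_prop) ((continuous_div_sqrt_norm.comp continuous_fst).mul (by fun_prop))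

lemma differentiableAt_hyperbolaPoint (hw : w ≠ 0) :
    DifferentiableAt ℝ (fun P : ℂ × ℝ => hyperbolaPoint P.1 P.2) (w, θ) := by
  have hsqrt : DifferentiableAt ℝ (fun P : ℂ × ℝ => ((Real.sqrt ‖P.1‖ : ℝ) : ℂ)) (w, θ) :=
    Complex.ofRealCLM.differentiableAt.comp _
      ((differentiableAt_fst.norm ℂ hw).sqrt (norm_ne_zero_iff.2 hw))
  have hphase : DifferentiableAt ℝ (fun P : ℂ × ℝ => Complex.I * (P.2 : ℂ)) (w, θ) :=
    (Complex.ofRealCLM.differentiableAt.comp _ differentiableAt_snd).const_mul _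
  have hquot : DifferentiableAt ℝ (fun P : ℂ × ℝ => P.1 / ((Real.sqrt ‖P.1‖ : ℝ) : ℂ)) (w, θ) := by
    simp only [div_eq_mul_inv]
    exact differentiableAt_fst.mul (hsqrt.fun_inv (ofReal_sqrt_norm_ne_zero hw))
  exact (hsqrt.mul hphase.cexp).prodMk (hquot.mul hphase.neg.cexp)

lemma hasDerivAt_hyperbolaPoint_fst :
    HasDerivAt (fun θ => (hyperbolaPoint w θ).1) (Complex.I * (hyperbolaPoint w θ).1) θ := by
  have hphase : HasDerivAt (fun θ : ℝ => Complex.I * (θ : ℂ)) (Complex.I * 1) θ :=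
    (Complex.ofRealCLM.hasDerivAt (x := θ)).const_mul Complex.I
  refine (hphase.cexp.const_mul _).congr_deriv ?_
  rw [hyperbolaPoint, mul_one, ← mul_assoc, mul_comm]

end HyperbolaPoint

/-- The parametrization `(θ₀, s') ↦ (z, u, v)` of a circle fibration in `uv = g(z)` over the family
`z = exp (ℓ(s))` of points of the torus `(ℂ^*)^n`, where `ℓ` is meant not to depend on `θ₀`. -/
def torusFiberMap {n : ℕ} (g : (Fin n → ℂ) → ℂ) (ℓ : (Fin (n + 1) → ℝ) → Fin n → ℂ)
    (s : Fin (n + 1) → ℝ) : Ambient n :=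
  (fun i => Complex.exp (ℓ s i), hyperbolaPoint (g fun i => Complex.exp (ℓ s i)) (s 0))

section TorusFiberMap

variable {n : ℕ} {g : (Fin n → ℂ) → ℂ} {ℓ : (Fin (n + 1) → ℝ) → Fin n → ℂ}
  {s : Fin (n + 1) → ℝ}

lemma continuous_torusFiberMap (hg : ContinuousOn g {z | ∀ i, z i ≠ 0}) (hℓ : Continuous ℓ) :
    Continuous (torusFiberMap g ℓ) := by
  have hz : Continuous fun s i => Complex.exp (ℓ s i) := by fun_prop
  exact hz.prodMk (continuous_hyperbolaPoint.comp
    ((hg.comp_continuous hz fun s i => Complex.exp_ne_zero _).prodMk (continuous_apply 0)))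

lemma differentiableAt_torusFiberMap
    (hg : DifferentiableAt ℝ g fun i => Complex.exp (ℓ s i)) (hℓ : DifferentiableAt ℝ ℓ s)
    (hne : (g fun i => Complex.exp (ℓ s i)) ≠ 0) :
    DifferentiableAt ℝ (torusFiberMap g ℓ) s := by
  have hz : DifferentiableAt ℝ (fun s i => Complex.exp (ℓ s i)) s :=
    differentiableAt_pi.2 fun i => (differentiableAt_pi.1 hℓ i).cexp
  exact hz.prodMk ((differentiableAt_hyperbolaPoint hne).comp s
    ((hg.comp s hz).prodMk (differentiableAt_apply 0 s)))

lemma torusFiberMap_update_two_pi {b : Fin (n + 1)}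
    (hℓ : (fun i => Complex.exp (ℓ (Function.update s b (2 * Real.pi)) i)) =
      fun i => Complex.exp (ℓ (Function.update s b 0) i)) :
    torusFiberMap g ℓ (Function.update s b (2 * Real.pi)) =
      torusFiberMap g ℓ (Function.update s b 0) := by
  simp only [torusFiberMap, hℓ]
  obtain rfl | hb := eq_or_ne b 0
  · simp only [Function.update_self, hyperbolaPoint_two_pi]
  · simp only [Function.update_of_ne hb.symm]

lemma fderiv_torusFiberMap_fst_div (hΨ : DifferentiableAt ℝ (torusFiberMap g ℓ) s)
    (hℓ : DifferentiableAt ℝ ℓ s) (X : Fin (n + 1) → ℝ) (i : Fin n) :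
    (fderiv ℝ (torusFiberMap g ℓ) s X).1 i / (torusFiberMap g ℓ s).1 i = fderiv ℝ ℓ s X i := by
  have hz := (hasFDerivAt_pi'.1 hΨ.hasFDerivAt.fst i).unique
    (hasFDerivAt_pi'.1 hℓ.hasFDerivAt i).cexp
  have hX := congrArg (fun F => F X) hz
  exact (div_eq_iff (Complex.exp_ne_zero _)).2 (hX.trans (mul_comm _ _))

lemma fderiv_torusFiberMap_single_zero (hΨ : DifferentiableAt ℝ (torusFiberMap g ℓ) s)
    (hℓ : ∀ r, ℓ (Function.update s 0 r) = ℓ s) :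
    (fderiv ℝ (torusFiberMap g ℓ) s (Pi.single 0 1)).2.1 =
      Complex.I * (torusFiberMap g ℓ s).2.1 := by
  have hcomp := hΨ.hasFDerivAt.snd.fst.comp_hasDerivAt_of_eq (s 0)
    (hasDerivAt_update s 0 (s 0)) (Function.update_eq_self 0 s).symm
  simp only [Function.comp_def, torusFiberMap, hℓ, Function.update_self] at hcomp
  exact hcomp.unique hasDerivAt_hyperbolaPoint_fst

lemma fderiv_single_zero_eq_zero {E : Type*} [NormedAddCommGroup E] [NormedSpace ℝ E]
    {f : (Fin (n + 1) → ℝ) → E} (hf : DifferentiableAt ℝ f s)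
    (hconst : ∀ r, f (Function.update s 0 r) = f s) : fderiv ℝ f s (Pi.single 0 1) = 0 := by
  have hcomp := hf.hasFDerivAt.comp_hasDerivAt_of_eq (s 0)
    (hasDerivAt_update s 0 (s 0)) (Function.update_eq_self 0 s).symm
  simp only [Function.comp_def, hconst] at hcomp
  exact hcomp.unique (hasDerivAt_const _ _)

/-- `d log u = i dθ₀` along the direction of `θ₀`, in which `z` is constant. -/
lemma pullbackOmega_torusFiberMap (hg : DifferentiableAt ℝ g fun i => Complex.exp (ℓ s i))
    (hne : (g fun i => Complex.exp (ℓ s i)) ≠ 0) (hℓ : DifferentiableAt ℝ ℓ s)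
    (hconst : ∀ r, ℓ (Function.update s 0 r) = ℓ s) :
    pullbackOmega (torusFiberMap g ℓ) s =
      Complex.I * (Matrix.of fun c i : Fin n => fderiv ℝ ℓ s (Pi.single c.succ 1) i).det := by
  have hΨ := differentiableAt_torusFiberMap hg hℓ hne
  rw [pullbackOmega, Omega, Matrix.det_succ_column_zero, Fin.sum_univ_succ,
    Finset.sum_eq_zero fun i _ => ?_, ← Matrix.det_transpose]
  · simp only [Matrix.of_apply, Fin.cons_zero, Fin.val_zero, pow_zero, one_mul, add_zero,
      fderiv_torusFiberMap_single_zero hΨ hconst]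
    rw [mul_div_cancel_right₀ _ (show (torusFiberMap g ℓ s).2.1 ≠ 0 from
      hyperbolaPoint_fst_ne_zero hne)]
    congr 2
    ext c i
    simp only [Matrix.transpose_apply, Matrix.submatrix_apply, Matrix.of_apply,
      Fin.zero_succAbove, Fin.cons_succ, fderiv_torusFiberMap_fst_div hΨ hℓ]
  · simp only [Matrix.of_apply, Fin.cons_succ, fderiv_torusFiberMap_fst_div hΨ hℓ,
      fderiv_single_zero_eq_zero hℓ hconst, Pi.zero_apply, mul_zero, zero_mul]

end TorusFiberMap

/-! ### The period integral -/

lemma det_frame_I_smul {d : ℕ} {w γ : Fin (d + 1) → ℂ} {ξ : Matrix (Fin d) (Fin (d + 1)) ℂ} {N : ℂ}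
    {e : Fin d → ℂ} (hw : w = N • γ + e ᵥ* ξ) (a b : Fin d → ℂ) :
    (frame (Complex.I • γ)
      (Matrix.vecMulVec a w + Complex.I • (Matrix.vecMulVec b γ + ξ))).det =
      Complex.I ^ (d + 1) * (1 - Complex.I * (a ⬝ᵥ e)) * (frame γ ξ).det := by
  have hrows : Matrix.vecMulVec a w + Complex.I • (Matrix.vecMulVec b γ + ξ) =
      Matrix.vecMulVec (N • a + Complex.I • b) γ +
        (Complex.I • (1 + Matrix.vecMulVec (-Complex.I • a) e)) * ξ := by
    rw [hw, Matrix.smul_mul, Matrix.add_mul, Matrix.one_mul, Matrix.vecMulVec_mul,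
      Matrix.vecMulVec_add, Matrix.vecMulVec_smul, Matrix.add_vecMulVec,
      Matrix.smul_vecMulVec, Matrix.smul_vecMulVec, Matrix.smul_vecMulVec]
    simp only [smul_add, smul_smul, mul_neg, Complex.I_mul_I, neg_neg, one_smul]
    abel
  have hdet : (Complex.I • (1 + Matrix.vecMulVec (-Complex.I • a) e)).det =
      Complex.I ^ d * (1 - Complex.I * (a ⬝ᵥ e)) := by
    rw [Matrix.det_smul, Fintype.card_fin, det_one_add_vecMulVec, dotProduct_smul, smul_eq_mul,
      neg_mul, ← sub_eq_add_neg, dotProduct_comm]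
  rw [hrows, det_frame_smul_vecMulVec_add_mul, hdet]
  ring

/-- The logarithm `log t · (x + τ w) + √-1 (α γ + ∑_k η_k ξ_k)` of `zPoint`. -/
def logPoint {d : ℕ} (w γ : Fin (d + 1) → ℤ) (ξ : Matrix (Fin d) (Fin (d + 1)) ℤ) (t : ℝ)
    (x : Fin (d + 1) → ℝ) (τ α : ℝ) (η : Fin d → ℝ) (i : Fin (d + 1)) : ℂ :=
  ((Real.log t * (x i + τ * (w i : ℝ)) : ℝ) : ℂ) +
    Complex.I * ((α * (γ i : ℝ) + ∑ k, η k * (ξ k i : ℝ) : ℝ) : ℂ)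

/-- The logarithm of the `z`-component of the singular fiber, for given functions `τ` and `α` on
the space of the parameters `η`. -/
def fiberLog {d : ℕ} (w γ : Fin (d + 1) → ℤ) (ξ : Matrix (Fin d) (Fin (d + 1)) ℤ) (t : ℝ)
    (x : Fin (d + 1) → ℝ) (τ α : (Fin d → ℝ) → ℝ) (s : Fin (d + 2) → ℝ) : Fin (d + 1) → ℂ :=
  logPoint w γ ξ t x (τ (etaProj d s)) (α (etaProj d s) + s 1) (etaProj d s)

section FiberLog

variable {d : ℕ} {w γ : Fin (d + 1) → ℤ} {ξ : Matrix (Fin d) (Fin (d + 1)) ℤ} {t : ℝ}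
  {x : Fin (d + 1) → ℝ} {τ α : (Fin d → ℝ) → ℝ}

lemma contDiff_fiberLog {m : WithTop ℕ∞} (hτ : ContDiff ℝ m τ) (hα : ContDiff ℝ m α) :
    ContDiff ℝ m (fiberLog w γ ξ t x τ α) := by
  have hre : ∀ i, ContDiff ℝ m fun s => Real.log t * (x i + τ (etaProj d s) * w i) := by fun_prop
  have him : ∀ i, ContDiff ℝ m fun s : Fin (d + 2) → ℝ =>
      (α (etaProj d s) + s 1) * γ i + ∑ k, etaProj d s k * ξ k i := by fun_prop
  exact contDiff_pi.2 fun i => (Complex.ofRealCLM.contDiff.comp (hre i)).add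
    (contDiff_const.mul (Complex.ofRealCLM.contDiff.comp (him i)))

lemma fderiv_fiberLog_apply (hτ : ContDiff ℝ 1 τ) (hα : ContDiff ℝ 1 α) (s X : Fin (d + 2) → ℝ)
    (i : Fin (d + 1)) :
    fderiv ℝ (fiberLog w γ ξ t x τ α) s X i =
      ((Real.log t * (fderiv ℝ τ (etaProj d s) (etaProj d X) * w i) : ℝ) : ℂ) +
        Complex.I * (((fderiv ℝ α (etaProj d s) (etaProj d X) + X 1) * γ i +
          ∑ k, etaProj d X k * ξ k i : ℝ) : ℂ) := by
  have hline : ∀ {f : (Fin d → ℝ) → ℝ}, ContDiff ℝ 1 f → HasDerivAt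
      (fun h : ℝ => f (etaProj d (s + h • X))) (fderiv ℝ f (etaProj d s) (etaProj d X)) 0 :=
    fun hf => ((hf.differentiable one_ne_zero _).hasFDerivAt.comp s
      (etaProj d).hasFDerivAt).hasLineDerivAt X
  have hcoord : ∀ b, HasDerivAt (fun h : ℝ => (s + h • X) b) (X b) 0 := fun b =>
    ((ContinuousLinearMap.proj (R := ℝ) (φ := fun _ : Fin (d + 2) => ℝ) b).hasFDerivAt
      (x := s)).hasLineDerivAt X
  have hre := (((hline hτ).mul_const (w i : ℝ)).const_add (x i)).const_mul (Real.log t)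
  have him := (((hline hα).fun_add (hcoord 1)).mul_const (γ i : ℝ)).fun_add
    (HasDerivAt.fun_sum (u := Finset.univ) fun k _ => (hcoord k.succ.succ).mul_const (ξ k i : ℝ))
  have hℓ := (hasFDerivAt_pi'.1 ((contDiff_fiberLog (w := w) (γ := γ) (ξ := ξ) (t := t) (x := x)
    hτ hα).differentiable one_ne_zero s).hasFDerivAt i).hasLineDerivAt X
  exact hℓ.unique (hre.ofReal_comp.fun_add (him.ofReal_comp.const_mul Complex.I))

lemma fderiv_fiberLog_single_one (hτ : ContDiff ℝ 1 τ) (hα : ContDiff ℝ 1 α)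
    (s : Fin (d + 2) → ℝ) (i : Fin (d + 1)) :
    fderiv ℝ (fiberLog w γ ξ t x τ α) s (Pi.single 1 1) i = Complex.I * γ i := by
  rw [fderiv_fiberLog_apply hτ hα, etaProj_single_one]
  simp only [map_zero, zero_mul, mul_zero, Pi.single_eq_same, zero_add, one_mul, Pi.zero_apply,
    Finset.sum_const_zero, add_zero, Complex.ofReal_zero, Complex.ofReal_intCast]

lemma fderiv_fiberLog_single_succ_succ (hτ : ContDiff ℝ 1 τ) (hα : ContDiff ℝ 1 α)
    (s : Fin (d + 2) → ℝ) (k : Fin d) (i : Fin (d + 1)) :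
    fderiv ℝ (fiberLog w γ ξ t x τ α) s (Pi.single k.succ.succ 1) i =
      ((Real.log t * fderiv ℝ τ (etaProj d s) (Pi.single k 1) : ℝ) : ℂ) * w i +
        Complex.I * ((fderiv ℝ α (etaProj d s) (Pi.single k 1) : ℂ) * γ i + ξ k i) := by
  rw [fderiv_fiberLog_apply hτ hα, etaProj_single_succ_succ,
    Pi.single_eq_of_ne (Fin.succ_succ_ne_one k).symm]
  simp only [Pi.single_apply, ite_mul, one_mul, zero_mul, Finset.sum_ite_eq', Finset.mem_univ,
    if_true]
  push_cast
  ring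

lemma zPoint_eq_zPoint_of_phase {τ₀ α₁ α₂ : ℝ} {η₁ η₂ : Fin d → ℝ} (m : Fin (d + 1) → ℤ)
    (h : ∀ i, α₁ * (γ i : ℝ) + ∑ k, η₁ k * (ξ k i : ℝ) =
      α₂ * (γ i : ℝ) + ∑ k, η₂ k * (ξ k i : ℝ) + m i * (2 * Real.pi)) :
    zPoint w γ ξ t x τ₀ α₁ η₁ = zPoint w γ ξ t x τ₀ α₂ η₂ := by
  ext i
  refine Complex.exp_eq_exp_iff_exists_int.2 ⟨m i, ?_⟩
  rw [h i]
  push_cast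
  ring

lemma zPoint_add_int_mul_two_pi {τ₀ α₀ : ℝ} {η : Fin d → ℝ} (m : ℤ) :
    zPoint w γ ξ t x τ₀ (α₀ + m * (2 * Real.pi)) η = zPoint w γ ξ t x τ₀ α₀ η :=
  zPoint_eq_zPoint_of_phase (m • γ) fun i => by
    rw [Pi.smul_apply, smul_eq_mul]
    push_cast
    ring

lemma zPoint_update_two_pi {τ₀ α₀ : ℝ} {η : Fin d → ℝ} (k : Fin d) :
    zPoint w γ ξ t x τ₀ α₀ (Function.update η k (2 * Real.pi)) =
      zPoint w γ ξ t x τ₀ α₀ (Function.update η k 0) := by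
  refine zPoint_eq_zPoint_of_phase (ξ k) fun i => ?_
  have hsum : ∀ r : ℝ, ∑ l, Function.update η k r l * (ξ l i : ℝ) =
      r * ξ k i + ∑ l ∈ Finset.univ.erase k, η l * (ξ l i : ℝ) := fun r => by
    rw [← Finset.add_sum_erase _ _ (Finset.mem_univ k), Function.update_self]
    congr 1
    exact Finset.sum_congr rfl fun l hl => by
      rw [Function.update_of_ne (Finset.ne_of_mem_erase hl)]
  rw [hsum, hsum]
  ring

lemma exp_fiberLog_update_two_pi
    (hτ : ∀ η k, τ (Function.update η k 0) = τ (Function.update η k (2 * Real.pi)))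
    (hα : ∀ η k, α (Function.update η k 0) = α (Function.update η k (2 * Real.pi)))
    (s : Fin (d + 2) → ℝ) (b : Fin (d + 2)) :
    (fun i => Complex.exp (fiberLog w γ ξ t x τ α (Function.update s b (2 * Real.pi)) i)) =
      fun i => Complex.exp (fiberLog w γ ξ t x τ α (Function.update s b 0) i) := by
  change zPoint w γ ξ t x _ _ _ = zPoint w γ ξ t x _ _ _
  refine Fin.cases ?_ (Fin.cases ?_ fun k => ?_) b
  · simp only [etaProj_update_zero, Function.update_of_ne (one_ne_zero (α := Fin (d + 2)))]
  · simp only [Fin.succ_zero_eq_one, etaProj_update_one, Function.update_self]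
    simpa using zPoint_add_int_mul_two_pi (α₀ := α (etaProj d s)) 1
  · simp only [etaProj_update_succ_succ, Function.update_of_ne (Fin.succ_succ_ne_one k).symm,
      ← hτ, ← hα, zPoint_update_two_pi]

lemma det_fderiv_fiberLog (hτ : ContDiff ℝ 1 τ) (hα : ContDiff ℝ 1 α) {N : ℝ} {e : Fin d → ℝ}
    (hw : realVec w = N • realVec γ + e ᵥ* realMat ξ) (s : Fin (d + 2) → ℝ) :
    (Matrix.of fun c i => fderiv ℝ (fiberLog w γ ξ t x τ α) s (Pi.single c.succ 1) i).det =
      Complex.I ^ (d + 1) * (1 - Complex.I * (Real.log t * fderiv ℝ τ (etaProj d s) e : ℝ)) *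
        (frame γ ξ).det := by
  set a : Fin d → ℂ := fun k =>
    ((Real.log t * fderiv ℝ τ (etaProj d s) (Pi.single k 1) : ℝ) : ℂ) with ha
  set b : Fin d → ℂ := fun k => (fderiv ℝ α (etaProj d s) (Pi.single k 1) : ℂ) with hb
  have hwC : Complex.ofRealHom ∘ realVec w = (N : ℂ) • (Complex.ofRealHom ∘ realVec γ) +
      (Complex.ofRealHom ∘ e) ᵥ* (realMat ξ).map Complex.ofRealHom := by
    ext i
    simp only [hw, Function.comp_apply, Pi.add_apply, Pi.smul_apply, smul_eq_mul, map_add, map_mul,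
      RingHom.map_vecMul, Complex.ofRealHom_eq_coe]
  have hrows : (Matrix.of fun c i => fderiv ℝ (fiberLog w γ ξ t x τ α) s (Pi.single c.succ 1) i) =
      frame (Complex.I • (Complex.ofRealHom ∘ realVec γ))
        (Matrix.vecMulVec a (Complex.ofRealHom ∘ realVec w) +
          Complex.I • (Matrix.vecMulVec b (Complex.ofRealHom ∘ realVec γ) +
            (realMat ξ).map Complex.ofRealHom)) := by
    ext c i
    refine Fin.cases ?_ (fun k => ?_) c
    · simp [fderiv_fiberLog_single_one hτ hα, realVec]
    · simp [fderiv_fiberLog_single_succ_succ hτ hα, realVec, realMat, ha, hb,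
        Matrix.vecMulVec_apply, mul_add]
  have hae : a ⬝ᵥ (Complex.ofRealHom ∘ e) = (Real.log t * fderiv ℝ τ (etaProj d s) e : ℝ) := by
    conv_rhs => rw [pi_eq_sum_univ' e, map_sum]
    simp only [map_smul, smul_eq_mul, dotProduct, ha, Function.comp_apply,
      Complex.ofRealHom_eq_coe, Finset.mul_sum, Complex.ofReal_sum, Complex.ofReal_mul]
    exact Finset.sum_congr rfl fun k _ => by ring
  rw [hrows, det_frame_I_smul hwC, det_frame_map, det_frame_realVec_realMat, hae,
    Complex.ofRealHom_eq_coe, Complex.ofReal_intCast]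

lemma pullbackOmega_torusFiberMap_fiberLog {g : (Fin (d + 1) → ℂ) → ℂ}
    (hg : ∀ z : Fin (d + 1) → ℂ, (∀ i, z i ≠ 0) → DifferentiableAt ℝ g z) (hτ : ContDiff ℝ 1 τ)
    (hα : ContDiff ℝ 1 α) {N : ℝ} {e : Fin d → ℝ}
    (hw : realVec w = N • realVec γ + e ᵥ* realMat ξ) {s : Fin (d + 2) → ℝ}
    (hne : g (fun i => Complex.exp (fiberLog w γ ξ t x τ α s i)) ≠ 0) :
    pullbackOmega (torusFiberMap g (fiberLog w γ ξ t x τ α)) s =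
      Complex.I ^ (d + 2) * (frame γ ξ).det *
        (1 - Complex.I * (Real.log t * fderiv ℝ τ (etaProj d s) e : ℝ)) := by
  have hconst : ∀ r, fiberLog w γ ξ t x τ α (Function.update s 0 r) = fiberLog w γ ξ t x τ α s :=
    fun r => by
      simp only [fiberLog, etaProj_update_zero,
        Function.update_of_ne (one_ne_zero (α := Fin (d + 2)))]
  rw [pullbackOmega_torusFiberMap (hg _ fun i => Complex.exp_ne_zero _) hne
    ((contDiff_fiberLog hτ hα).differentiable one_ne_zero s) hconst, det_fderiv_fiberLog hτ hα hw]
  ring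

lemma pullbackOmega_torusFiberMap_fiberLog_ae_eq {g : (Fin (d + 1) → ℂ) → ℂ}
    (hg : ∀ z : Fin (d + 1) → ℂ, (∀ i, z i ≠ 0) → DifferentiableAt ℝ g z) (hτ : ContDiff ℝ 1 τ)
    (hα : ContDiff ℝ 1 α) (hne : ∀ s : Fin (d + 2) → ℝ, s 1 ∈ Ioo 0 (2 * Real.pi) →
      g (fun i => Complex.exp (fiberLog w γ ξ t x τ α s i)) ≠ 0) {N : ℝ} {e : Fin d → ℝ}
    (hw : realVec w = N • realVec γ + e ᵥ* realMat ξ) :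
    pullbackOmega (torusFiberMap g (fiberLog w γ ξ t x τ α)) =ᵐ[volume.restrict (cube (d + 2))]
      fun s => Complex.I ^ (d + 2) * (frame γ ξ).det *
        (1 - Complex.I * (Real.log t * fderiv ℝ τ (etaProj d s) e : ℝ)) :=
  ae_restrict_cube_of_forall_mem_Ioo fun s hs =>
    pullbackOmega_torusFiberMap_fiberLog hg hτ hα hw (hne s (hs 1))

lemma continuous_fderiv_etaProj_apply (hτ : ContDiff ℝ 1 τ) (e : Fin d → ℝ) :
    Continuous fun s => fderiv ℝ τ (etaProj d s) e :=
  ((hτ.continuous_fderiv one_ne_zero).comp (etaProj d).continuous).clm_apply continuous_const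

lemma integrableOn_pullbackOmega_torusFiberMap_fiberLog {g : (Fin (d + 1) → ℂ) → ℂ}
    (hg : ∀ z : Fin (d + 1) → ℂ, (∀ i, z i ≠ 0) → DifferentiableAt ℝ g z) (hτ : ContDiff ℝ 1 τ)
    (hα : ContDiff ℝ 1 α) (hne : ∀ s : Fin (d + 2) → ℝ, s 1 ∈ Ioo 0 (2 * Real.pi) →
      g (fun i => Complex.exp (fiberLog w γ ξ t x τ α s i)) ≠ 0) {N : ℝ} {e : Fin d → ℝ}
    (hw : realVec w = N • realVec γ + e ᵥ* realMat ξ) :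
    IntegrableOn (pullbackOmega (torusFiberMap g (fiberLog w γ ξ t x τ α))) (cube (d + 2)) := by
  have := continuous_fderiv_etaProj_apply hτ e
  exact (integrableOn_cube_of_continuous (by fun_prop)).congr
    (pullbackOmega_torusFiberMap_fiberLog_ae_eq hg hτ hα hne hw).symm

lemma setIntegral_pullbackOmega_torusFiberMap_fiberLog {g : (Fin (d + 1) → ℂ) → ℂ}
    (hg : ∀ z : Fin (d + 1) → ℂ, (∀ i, z i ≠ 0) → DifferentiableAt ℝ g z) (hτ : ContDiff ℝ 1 τ)
    (hα : ContDiff ℝ 1 α)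
    (hper : ∀ η k, τ (Function.update η k 0) = τ (Function.update η k (2 * Real.pi)))
    (hne : ∀ s : Fin (d + 2) → ℝ, s 1 ∈ Ioo 0 (2 * Real.pi) →
      g (fun i => Complex.exp (fiberLog w γ ξ t x τ α s i)) ≠ 0) {N : ℝ} {e : Fin d → ℝ}
    (hw : realVec w = N • realVec γ + e ᵥ* realMat ξ) :
    ∫ s in cube (d + 2), pullbackOmega (torusFiberMap g (fiberLog w γ ξ t x τ α)) s =
      (2 * (Real.pi : ℂ) * Complex.I) ^ (d + 2) * (frame γ ξ).det := by
  have := continuous_fderiv_etaProj_apply hτ e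
  calc ∫ s in cube (d + 2), pullbackOmega (torusFiberMap g (fiberLog w γ ξ t x τ α)) s
      = Complex.I ^ (d + 2) * (frame γ ξ).det * ((∫ _ in cube (d + 2), (1 : ℂ)) -
          Complex.I * (Real.log t * ∫ s in cube (d + 2), fderiv ℝ τ (etaProj d s) e : ℝ)) := by
        rw [integral_congr_ae (pullbackOmega_torusFiberMap_fiberLog_ae_eq hg hτ hα hne hw),
          integral_const_mul, integral_sub (integrableOn_cube_of_continuous continuous_const)
          (integrableOn_cube_of_continuous (by fun_prop)), integral_const_mul,
          integral_complex_ofReal, integral_const_mul]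
    _ = (2 * (Real.pi : ℂ) * Complex.I) ^ (d + 2) * (frame γ ξ).det := by
        rw [setIntegral_cube_fderiv_etaProj_eq_zero hτ hper, setIntegral_const, volume_real_cube,
          Complex.real_smul]
        push_cast
        ring

end FiberLog

/-! ### The tropical estimate -/

/-- The term `t^{λ_k} z^{v_k}` of `W_Σ`. -/
def laurentTerm {n p : ℕ} (v : Fin p → Fin n → ℤ) (lam : Fin p → ℝ) (t : ℝ) (k : Fin p)
    (z : Fin n → ℂ) : ℂ :=
  ((t ^ lam k : ℝ) : ℂ) * monomial (v k) z

lemma Wj_eq_add_sum {n p : ℕ} (v : Fin p → Fin n → ℤ) (lam : Fin p → ℝ) (j : Fin p) (t : ℝ)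
    (ρ : (Fin n → ℝ) → ℝ) (z : Fin n → ℂ) :
    Wj v lam j t ρ z = 1 + laurentTerm v lam t j z +
      ∑ k : {k // k ≠ j}, ((1 - ρ (LogT t z) : ℝ) : ℂ) * laurentTerm v lam t k z := by
  have hW : W v lam t z = 1 + ∑ k, laurentTerm v lam t k z := rfl
  have hsub : ∑ k ∈ Finset.univ.filter (· ≠ j), laurentTerm v lam t k z =
      ∑ k : {k // k ≠ j}, laurentTerm v lam t k z :=
    Finset.sum_subtype _ (fun k => by simp) _
  change W v lam t z - _ * ∑ k ∈ Finset.univ.filter (· ≠ j), laurentTerm v lam t k z = _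
  rw [hsub, hW, Fintype.sum_eq_add_sum_subtype_ne _ j, ← Finset.mul_sum]
  push_cast
  ring

lemma monomial_exp {n : ℕ} (m : Fin n → ℤ) (ℓ : Fin n → ℂ) :
    monomial m (fun i => Complex.exp (ℓ i)) = Complex.exp (∑ i, m i * ℓ i) := by
  rw [monomial, Complex.exp_sum]
  exact Finset.prod_congr rfl fun i _ => (Complex.exp_int_mul _ _).symm

lemma abs_le_one_of_norm_one_add_exp_le {ω : ℂ} (h : ‖1 + Complex.exp ω‖ ≤ 1 / 2) :
    |ω.re| ≤ 1 := by
  have hexp : |Real.exp ω.re - 1| ≤ 1 / 2 := by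
    have := abs_norm_sub_norm_le (Complex.exp ω) (-1)
    rw [Complex.norm_exp, norm_neg, norm_one, sub_neg_eq_add, add_comm _ (1 : ℂ)] at this
    exact this.trans h
  obtain ⟨hlow, hupp⟩ := abs_le.1 hexp
  have he := Real.exp_one_gt_d9
  refine abs_le.2 ⟨?_, ?_⟩ <;> rw [← Real.exp_le_exp]
  · rw [Real.exp_neg]
    have : (Real.exp 1)⁻¹ ≤ 1 / 2 := by
      rw [inv_le_comm₀ (Real.exp_pos 1) (by norm_num)]
      linarith
    linarith
  · linarith

lemma differentiableAt_Wj_const {n p : ℕ} (v : Fin p → Fin n → ℤ) (lam : Fin p → ℝ) (j : Fin p)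
    (t r : ℝ) {z : Fin n → ℂ} (hz : ∀ i, z i ≠ 0) :
    DifferentiableAt ℝ (Wj v lam j t fun _ => r) z := by
  have hterm : ∀ k, DifferentiableAt ℝ (laurentTerm v lam t k) z := fun k => by
    have hpow : ∀ i, DifferentiableAt ℂ (fun z : Fin n → ℂ => z i ^ v k i) z := fun i =>
      (differentiableAt_apply i z).zpow (Or.inl (hz i))
    exact ((HasFDerivAt.finsetProd fun i _ =>
      (hpow i).hasFDerivAt).differentiableAt.restrictScalars ℝ).const_mul _
  rw [funext (Wj_eq_add_sum v lam j t fun _ => r)]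
  exact ((hterm j).const_add _).add (DifferentiableAt.fun_sum fun k _ => (hterm k).const_mul _)

section Fiber

variable {d p : ℕ} {v : Fin p → Fin (d + 1) → ℤ} {lam : Fin p → ℝ} {j : Fin p} {t : ℝ}
  {w γ : Fin (d + 1) → ℤ} {ξ : Matrix (Fin d) (Fin (d + 1)) ℤ} {x : Fin (d + 1) → ℝ}

lemma LogT_zPoint (ht : Real.log t ≠ 0) (τ α : ℝ) (η : Fin d → ℝ) :
    LogT t (zPoint w γ ξ t x τ α η) = x + τ • realVec w := by
  ext i
  simp [LogT, zPoint, Complex.norm_exp, realVec, ht]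

lemma chi_add_smul (k : Fin p) (y u : Fin (d + 1) → ℝ) (r : ℝ) :
    chi v lam k (y + r • u) = chi v lam k y + r * (realVec (v k) ⬝ᵥ u) := by
  change lam k + realVec (v k) ⬝ᵥ (y + r • u) = lam k + realVec (v k) ⬝ᵥ y + _
  rw [dotProduct_add, dotProduct_smul, smul_eq_mul, add_assoc]

lemma laurentTerm_zPoint (ht : 0 < t) (k : Fin p) (τ α : ℝ) (η : Fin d → ℝ) :
    laurentTerm v lam t k (zPoint w γ ξ t x τ α η) =
      Complex.exp (((Real.log t * chi v lam k (x + τ • realVec w) : ℝ) : ℂ) +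
        Complex.I * ((α * (γ ⬝ᵥ v k : ℤ) + η ⬝ᵥ realVec (ξ *ᵥ v k) : ℝ) : ℂ)) := by
  have hphase : realVec (v k) ⬝ᵥ (α • realVec γ + η ᵥ* realMat ξ) =
      α * (γ ⬝ᵥ v k : ℤ) + η ⬝ᵥ realVec (ξ *ᵥ v k) := by
    rw [dotProduct_comm, add_dotProduct, smul_dotProduct, realVec_dotProduct, smul_eq_mul,
      ← Matrix.dotProduct_mulVec, realMat_mulVec_realVec]
  have hsum : ∑ i, (v k i : ℂ) * logPoint w γ ξ t x τ α η i =
      ((Real.log t * (realVec (v k) ⬝ᵥ (x + τ • realVec w)) : ℝ) : ℂ) +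
        Complex.I * ((realVec (v k) ⬝ᵥ (α • realVec γ + η ᵥ* realMat ξ) : ℝ) : ℂ) := by
    simp only [dotProduct, Complex.ofReal_mul, Complex.ofReal_sum, Finset.mul_sum,
      ← Finset.sum_add_distrib]
    refine Finset.sum_congr rfl fun i _ => ?_
    change (v k i : ℂ) * (((Real.log t * (x + τ • realVec w) i : ℝ) : ℂ) +
      Complex.I * (((α • realVec γ + η ᵥ* realMat ξ) i : ℝ) : ℂ)) = _
    rw [realVec, Complex.ofReal_intCast]
    push_cast
    ring
  change _ * monomial (v k) (fun i => Complex.exp (logPoint w γ ξ t x τ α η i)) = _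
  rw [monomial_exp, hsum, hphase, Real.rpow_def_of_pos ht, Complex.ofReal_exp, ← Complex.exp_add,
    ← add_assoc, ← Complex.ofReal_add, ← mul_add]
  rfl

lemma norm_laurentTerm_zPoint (ht : 0 < t) (k : Fin p) (τ α : ℝ) (η : Fin d → ℝ) :
    ‖laurentTerm v lam t k (zPoint w γ ξ t x τ α η)‖ = t ^ chi v lam k (x + τ • realVec w) := by
  rw [laurentTerm_zPoint ht, Complex.exp_add, norm_mul, mul_comm Complex.I,
    Complex.norm_exp_ofReal_mul_I, mul_one, ← Complex.ofReal_exp, Complex.norm_real,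
    Real.norm_of_nonneg (Real.exp_pos _).le, Real.rpow_def_of_pos ht]

/-- The coefficients of the perturbation of `1 + e^ω` given by `W_{Σ,j}` on the fiber over
`x + ℝ v_j`, for a cut-off function with the constant value `r`. -/
def tropCoeff {d p : ℕ} (v : Fin p → Fin (d + 1) → ℤ) (lam : Fin p → ℝ) (j : Fin p)
    (ξ : Matrix (Fin d) (Fin (d + 1)) ℤ) (t : ℝ) (x : Fin (d + 1) → ℝ) (r : ℝ) (η : Fin d → ℝ)
    (k : {k // k ≠ j}) : ℂ :=
  ((1 - r : ℝ) : ℂ) * Complex.exp (((Real.log t * chi v lam k x : ℝ) : ℂ) +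
    Complex.I * ((η ⬝ᵥ realVec (ξ *ᵥ v k) : ℝ) : ℂ))

lemma contDiff_tropCoeff {m : WithTop ℕ∞} :
    ContDiff ℝ m fun P : ℝ × (Fin d → ℝ) => tropCoeff v lam j ξ t x P.1 P.2 := by
  refine contDiff_pi.2 fun k => ?_
  have hr : ContDiff ℝ m fun P : ℝ × (Fin d → ℝ) => 1 - P.1 := by fun_prop
  have hη : ContDiff ℝ m fun P : ℝ × (Fin d → ℝ) => P.2 ⬝ᵥ realVec (ξ *ᵥ v k) := by
    simp only [dotProduct]
    fun_prop
  exact (Complex.ofRealCLM.contDiff.comp hr).mul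
    (contDiff_const.add (contDiff_const.mul (Complex.ofRealCLM.contDiff.comp hη))).cexp

lemma norm_tropCoeff_le (ht : 0 < t) (ht1 : t ≤ 1) {c r : ℝ} (hr : r ∈ Icc (0 : ℝ) 1)
    (hc : ∀ k, k ≠ j → c ≤ chi v lam k x) (η : Fin d → ℝ) :
    ‖tropCoeff v lam j ξ t x r η‖ ≤ t ^ c := by
  refine (pi_norm_le_iff_of_nonneg (Real.rpow_nonneg ht.le c)).2 fun k => ?_
  have hr1 : |1 - r| ≤ 1 := abs_le.2 ⟨by linarith [hr.2], by linarith [hr.1]⟩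
  rw [tropCoeff, norm_mul, Complex.exp_add, norm_mul, mul_comm Complex.I,
    Complex.norm_exp_ofReal_mul_I, mul_one, ← Complex.ofReal_exp, Complex.norm_real,
    Complex.norm_real, Real.norm_of_nonneg (Real.exp_pos _).le, ← Real.rpow_def_of_pos ht]
  calc |1 - r| * t ^ chi v lam k x
    _ ≤ 1 * t ^ c := mul_le_mul hr1 (Real.rpow_le_rpow_of_exponent_ge ht ht1 (hc k k.2))
        (Real.rpow_nonneg ht.le _) zero_le_one
    _ = t ^ c := one_mul _

/-- The value of `ω = log (t^{λ_j} z^{v_j})` at the point of the fiber with parameters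
`s = (τ, α)`. -/
def leadingLog (w : Fin (d + 1) → ℤ) (t : ℝ) (s : ℝ × ℝ) : ℂ :=
  ⟨Real.log t * (s.1 * (w ⬝ᵥ w : ℤ)), s.2⟩

lemma laurentTerm_zPoint_self (ht : 0 < t) (hγ : γ ⬝ᵥ v j = 1) (hperp : ξ *ᵥ v j = 0)
    (hx : chi v lam j x = 0) (s : ℝ × ℝ) (η : Fin d → ℝ) :
    laurentTerm v lam t j (zPoint (v j) γ ξ t x s.1 s.2 η) =
      Complex.exp (leadingLog (v j) t s) := by
  have h0 : η ⬝ᵥ realVec (0 : Fin d → ℤ) = 0 := by simp [realVec, dotProduct]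
  rw [laurentTerm_zPoint ht, chi_add_smul, realVec_dotProduct, hγ, hperp, hx, h0, Int.cast_one,
    zero_add, mul_one, add_zero]
  congr 1
  apply Complex.ext <;> simp [leadingLog]

lemma Wj_zPoint_eq_perturbedExp (ht : 0 < t) (hγ : γ ⬝ᵥ v j = 1) (hperp : ξ *ᵥ v j = 0)
    (hx : chi v lam j x = 0) (r : ℝ) (s : ℝ × ℝ) (η : Fin d → ℝ) :
    Wj v lam j t (fun _ => r) (zPoint (v j) γ ξ t x s.1 s.2 η) =
      perturbedExp (fun k : {k // k ≠ j} => ((v k ⬝ᵥ v j : ℤ) : ℝ) / (v j ⬝ᵥ v j : ℤ))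
        (fun k => (γ ⬝ᵥ v k : ℤ)) (tropCoeff v lam j ξ t x r η, leadingLog (v j) t s) := by
  have hw : ((v j ⬝ᵥ v j : ℤ) : ℝ) ≠ 0 :=
    Int.cast_ne_zero.2 (dotProduct_self_pos_of_dotProduct_eq_one hγ).ne'
  rw [Wj_eq_add_sum, laurentTerm_zPoint_self ht hγ hperp hx, perturbedExp]
  congr 1
  refine Finset.sum_congr rfl fun k _ => ?_
  have hre : ((v k ⬝ᵥ v j : ℤ) : ℝ) / (v j ⬝ᵥ v j : ℤ) * (leadingLog (v j) t s).re =
      Real.log t * (s.1 * (v k ⬝ᵥ v j : ℤ)) := by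
    rw [leadingLog]
    field_simp
  rw [laurentTerm_zPoint ht, chi_add_smul, realVec_dotProduct, hre]
  simp only [tropCoeff, leadingLog, mul_assoc, ← Complex.exp_add]
  congr 2
  push_cast
  ring

lemma abs_re_leadingLog_le_one {c r : ℝ} (ht : 0 < t) (ht1 : t ≤ 1) (hγ : γ ⬝ᵥ v j = 1)
    (hperp : ξ *ᵥ v j = 0) (hx : chi v lam j x = 0) (hr : r ∈ Icc (0 : ℝ) 1) {s : ℝ × ℝ}
    {η : Fin d → ℝ} (hc : ∀ k, k ≠ j → c ≤ chi v lam k (x + s.1 • realVec (v j)))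
    (hp : Fintype.card {k // k ≠ j} * t ^ c ≤ 1 / 2)
    (h0 : Wj v lam j t (fun _ => r) (zPoint (v j) γ ξ t x s.1 s.2 η) = 0) :
    |(leadingLog (v j) t s).re| ≤ 1 := by
  have hr1 : |1 - r| ≤ 1 := abs_le.2 ⟨by linarith [hr.2], by linarith [hr.1]⟩
  have hterm : ∀ k : {k // k ≠ j}, ‖((1 - r : ℝ) : ℂ) *
      laurentTerm v lam t k (zPoint (v j) γ ξ t x s.1 s.2 η)‖ ≤ t ^ c := fun k => by
    rw [norm_mul, Complex.norm_real, norm_laurentTerm_zPoint ht]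
    calc |1 - r| * t ^ chi v lam k (x + s.1 • realVec (v j))
      _ ≤ 1 * t ^ c := mul_le_mul hr1 (Real.rpow_le_rpow_of_exponent_ge ht ht1 (hc k k.2))
          (Real.rpow_nonneg ht.le _) zero_le_one
      _ = t ^ c := one_mul _
  rw [Wj_eq_add_sum, laurentTerm_zPoint_self ht hγ hperp hx] at h0
  refine abs_le_one_of_norm_one_add_exp_le ?_
  calc ‖1 + Complex.exp (leadingLog (v j) t s)‖
    _ = ‖∑ k : {k // k ≠ j}, ((1 - r : ℝ) : ℂ) *
          laurentTerm v lam t k (zPoint (v j) γ ξ t x s.1 s.2 η)‖ := by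
        rw [eq_neg_of_add_eq_zero_left h0, norm_neg]
    _ ≤ Fintype.card {k // k ≠ j} * t ^ c := by
        simpa using norm_sum_le_of_le Finset.univ fun k _ => hterm k
    _ ≤ 1 / 2 := hp

end Fiber

/-! ### Solutions for constant cut-off values -/

lemma eventually_tropical_bounds {c ε δ S : ℝ} (N : ℕ) (hc : 0 < c) (hε : 0 < ε) (hδ : 0 < δ)
    (hS : 0 < S) :
    ∀ᶠ t : ℝ in 𝓝[>] 0,
      0 < t ∧ t < 1 ∧ N * t ^ c ≤ 1 / 2 ∧ t ^ c < ε ∧ 1 < δ * (-Real.log t * S) := by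
  have hpow : Tendsto (fun t : ℝ => t ^ c) (𝓝[>] 0) (𝓝 0) := by
    simpa only [Real.zero_rpow hc.ne'] using
      (Real.continuousAt_rpow_const 0 c (Or.inr hc.le)).tendsto.mono_left nhdsWithin_le_nhds
  have hsum : Tendsto (fun t : ℝ => N * t ^ c) (𝓝[>] 0) (𝓝 0) := by
    simpa only [mul_zero] using hpow.const_mul (N : ℝ)
  filter_upwards [self_mem_nhdsWithin, nhdsWithin_le_nhds (Iio_mem_nhds one_pos),
    hsum.eventually_le_const (by norm_num : (0 : ℝ) < 1 / 2), hpow.eventually_lt_const hε,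
    Real.tendsto_log_nhdsGT_zero.eventually_lt_atBot (-(1 / (δ * S)))]
    with t ht ht1 hN hlt hlog
  refine ⟨ht, ht1, hN, hlt, ?_⟩
  have := (div_lt_iff₀ (mul_pos hδ hS)).1 (lt_neg_of_lt_neg hlog)
  linarith

section Solutions

variable {d p : ℕ} {v : Fin p → Fin (d + 1) → ℤ} {lam : Fin p → ℝ} {j : Fin p}
  {U : Set (Fin (d + 1) → ℝ)} {t : ℝ} {ρ : (Fin (d + 1) → ℝ) → ℝ} {w γ : Fin (d + 1) → ℤ}
  {ξ : Matrix (Fin d) (Fin (d + 1)) ℤ} {x : Fin (d + 1) → ℝ}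

lemma isSolution_iff (ht : Real.log t ≠ 0) {η : Fin d → ℝ} {s : ℝ × ℝ} :
    IsSolution v lam j U t ρ γ ξ x η s ↔ s.2 ∈ Ico 0 (2 * Real.pi) ∧
      x + s.1 • realVec (v j) ∈ U ∧ Wj v lam j t ρ (zPoint (v j) γ ξ t x s.1 s.2 η) = 0 := by
  refine ⟨fun ⟨hα, hβ, h0⟩ => ⟨hα, hβ.1.2, h0⟩, fun ⟨hα, hU, h0⟩ =>
    ⟨hα, ⟨⟨⟨_, rfl⟩, hU⟩, _, ⟨fun i => Complex.exp_ne_zero _, h0⟩, ?_⟩, h0⟩⟩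
  exact LogT_zPoint ht _ _ _

lemma Wj_zPoint_eq_const (ht : Real.log t ≠ 0) (τ α : ℝ) (η : Fin d → ℝ) :
    Wj v lam j t ρ (zPoint w γ ξ t x τ α η) =
      Wj v lam j t (fun _ => ρ (x + τ • realVec w)) (zPoint w γ ξ t x τ α η) := by
  rw [Wj, Wj, LogT_zPoint ht]

lemma isSolution_iff_const (ht : Real.log t ≠ 0) {η : Fin d → ℝ} {s : ℝ × ℝ} :
    IsSolution v lam j U t ρ γ ξ x η s ↔
      IsSolution v lam j U t (fun _ => ρ (x + s.1 • realVec (v j))) γ ξ x η s := by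
  rw [isSolution_iff ht, isSolution_iff ht, Wj_zPoint_eq_const ht]

lemma leadingLog_eq_iff (hw : 0 < w ⬝ᵥ w) (ht : Real.log t ≠ 0) {s : ℝ × ℝ} {ω : ℂ} :
    leadingLog w t s = ω ↔ s = (ω.re / (Real.log t * (w ⬝ᵥ w : ℤ)), ω.im) := by
  have hκ : Real.log t * ((w ⬝ᵥ w : ℤ) : ℝ) ≠ 0 := mul_ne_zero ht (Int.cast_ne_zero.2 hw.ne')
  rw [Complex.ext_iff, Prod.ext_iff, eq_div_iff hκ, leadingLog, mul_left_comm]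

/-- `T r` is the map `η ↦ (τ_x(η), α_x(η))` for the cut-off function with the constant value `r`;
this map exists, is unique and depends smoothly on all parameters. -/
structure IsSolutionMap {d p : ℕ} (v : Fin p → Fin (d + 1) → ℤ) (lam : Fin p → ℝ) (j : Fin p)
    (U : Set (Fin (d + 1) → ℝ)) (t : ℝ) (γ : Fin (d + 1) → ℤ)
    (ξ : Matrix (Fin d) (Fin (d + 1)) ℤ) (x : Fin (d + 1) → ℝ)
    (T : ℝ → (Fin d → ℝ) → ℝ × ℝ) : Prop where
  isSolution_iff : ∀ r ∈ Icc (0 : ℝ) 1, ∀ η s,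
    IsSolution v lam j U t (fun _ => r) γ ξ x η s ↔ s = T r η
  contDiffAt : ∀ r ∈ Icc (0 : ℝ) 1, ∀ η,
    ContDiffAt ℝ 1 (fun P : ℝ × (Fin d → ℝ) => T P.1 P.2) (r, η)

lemma isSolution_const_iff_leadingLog_eq {c δ r : ℝ} {η : Fin d → ℝ} {s : ℝ × ℝ} {ω₀ : ℂ}
    (hγ : γ ⬝ᵥ v j = 1) (hperp : ξ *ᵥ v j = 0) (ht : 0 < t) (ht1 : t < 1)
    (hp : Fintype.card {k // k ≠ j} * t ^ c ≤ 1 / 2)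
    (htδ : 1 < δ * (-Real.log t * (v j ⬝ᵥ v j : ℤ))) (hx : chi v lam j x = 0)
    (hc : ∀ y ∈ U, ∀ k, k ≠ j → c ≤ chi v lam k y)
    (hδ : ∀ τ : ℝ, |τ| < δ → x + τ • realVec (v j) ∈ U) (hr : r ∈ Icc (0 : ℝ) 1)
    (hω₀ : ω₀ ∈ interior rootBox)
    (hroot : ∀ ω ∈ rootBox, perturbedExp
      (fun k : {k // k ≠ j} => ((v k ⬝ᵥ v j : ℤ) : ℝ) / (v j ⬝ᵥ v j : ℤ))
      (fun k => (γ ⬝ᵥ v k : ℤ)) (tropCoeff v lam j ξ t x r η, ω) = 0 ↔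
        ω = ω₀) :
    IsSolution v lam j U t (fun _ => r) γ ξ x η s ↔ leadingLog (v j) t s = ω₀ := by
  have hlog := Real.log_neg ht ht1
  have hw := dotProduct_self_pos_of_dotProduct_eq_one hγ
  rw [isSolution_iff hlog.ne, Wj_zPoint_eq_perturbedExp ht hγ hperp hx]
  constructor
  · rintro ⟨hα, hU, h0⟩
    refine (hroot _ (mem_rootBox.2 ⟨?_, Ico_subset_Icc_self hα⟩)).1 h0
    refine abs_re_leadingLog_le_one ht ht1.le hγ hperp hx hr (η := η) (hc _ hU) hp ?_
    rwa [Wj_zPoint_eq_perturbedExp ht hγ hperp hx]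
  · intro hs
    have hbox : leadingLog (v j) t s ∈ interior rootBox := hs ▸ hω₀
    obtain ⟨hre, him⟩ := mem_interior_rootBox.1 hbox
    refine ⟨Ioo_subset_Ico_self him, hδ _ ?_, (hroot _ (interior_subset hbox)).2 hs⟩
    have hκ : 0 < -Real.log t * ((v j ⬝ᵥ v j : ℤ) : ℝ) :=
      mul_pos (neg_pos.2 hlog) (Int.cast_pos.2 hw)
    refine lt_of_mul_lt_mul_right ?_ hκ.le
    calc |s.1| * (-Real.log t * ((v j ⬝ᵥ v j : ℤ) : ℝ))
      _ = |(leadingLog (v j) t s).re| := by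
        rw [leadingLog, ← abs_of_pos hκ, ← abs_mul, ← abs_neg]
        congr 1
        ring
      _ < 1 := hre
      _ < _ := htδ

lemma eventually_exists_isSolutionMap {K : Set (Fin (d + 1) → ℝ)} {c δ : ℝ}
    (hγ : γ ⬝ᵥ v j = 1) (hperp : ξ *ᵥ v j = 0) (hc : 0 < c)
    (hcU : ∀ y ∈ U, ∀ k, k ≠ j → c ≤ chi v lam k y) (hK : ∀ x ∈ K, chi v lam j x = 0)
    (hδ : 0 < δ) (hKU : ∀ x ∈ K, ∀ r : ℝ, |r| < δ → x + r • realVec (v j) ∈ U) :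
    ∀ᶠ t in 𝓝[>] 0, ∀ x ∈ K, ∃ T, IsSolutionMap v lam j U t γ ξ x T := by
  obtain ⟨ε, hε, φ, hφ⟩ := exists_perturbedExp_eq_zero_iff
    (fun k : {k // k ≠ j} => ((v k ⬝ᵥ v j : ℤ) : ℝ) / (v j ⬝ᵥ v j : ℤ))
    (fun k => ((γ ⬝ᵥ v k : ℤ) : ℝ))
  have hw := dotProduct_self_pos_of_dotProduct_eq_one hγ
  filter_upwards [eventually_tropical_bounds (Fintype.card {k // k ≠ j}) hc hε hδ
    (Int.cast_pos.2 hw)] with t ⟨ht, ht1, hp, htε, htδ⟩ x hx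
  have hxU : x ∈ U := by simpa using hKU x hx 0 (by rwa [abs_zero])
  have hA : ∀ r ∈ Icc (0 : ℝ) 1, ∀ η, ‖tropCoeff v lam j ξ t x r η‖ < ε := fun r hr η =>
    (norm_tropCoeff_le ht ht1.le hr (hcU x hxU) η).trans_lt htε
  refine ⟨fun r η => ((φ (tropCoeff v lam j ξ t x r η)).re / (Real.log t * (v j ⬝ᵥ v j : ℤ)),
    (φ (tropCoeff v lam j ξ t x r η)).im), fun r hr η s => ?_, fun r hr η => ?_⟩
  · obtain ⟨-, hbox, hroot⟩ := hφ _ (hA r hr η)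
    rw [← leadingLog_eq_iff hw (Real.log_neg ht ht1).ne]
    exact isSolution_const_iff_leadingLog_eq hγ hperp ht ht1 hp htδ (hK x hx) hcU (hKU x hx) hr
      hbox hroot
  · have hcomp : ContDiffAt ℝ 1
        (fun P : ℝ × (Fin d → ℝ) => φ (tropCoeff v lam j ξ t x P.1 P.2)) (r, η) :=
      (hφ _ (hA r hr η)).1.comp (r, η) contDiff_tropCoeff.contDiffAt
    exact ((Complex.reCLM.contDiff.contDiffAt.comp (r, η) hcomp).div_const _).prodMk
      (Complex.imCLM.contDiff.contDiffAt.comp (r, η) hcomp)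

namespace IsSolutionMap

variable {T : ℝ → (Fin d → ℝ) → ℝ × ℝ}

lemma contDiff (hT : IsSolutionMap v lam j U t γ ξ x T) {r : ℝ} (hr : r ∈ Icc (0 : ℝ) 1) :
    ContDiff ℝ 1 (T r) :=
  contDiff_iff_contDiffAt.2 fun η =>
    (hT.contDiffAt r hr η).comp η (contDiff_prodMk_right r).contDiffAt

lemma isSolution_self (hT : IsSolutionMap v lam j U t γ ξ x T) {r : ℝ}
    (hr : r ∈ Icc (0 : ℝ) 1) (η : Fin d → ℝ) :
    IsSolution v lam j U t (fun _ => r) γ ξ x η (T r η) :=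
  (hT.isSolution_iff r hr η _).2 rfl

lemma update_two_pi (hT : IsSolutionMap v lam j U t γ ξ x T) {r : ℝ}
    (hr : r ∈ Icc (0 : ℝ) 1) (η : Fin d → ℝ) (k : Fin d) :
    T r (Function.update η k 0) = T r (Function.update η k (2 * Real.pi)) := by
  obtain ⟨hα, hβ, h0⟩ := hT.isSolution_self hr (Function.update η k 0)
  exact (hT.isSolution_iff r hr _ _).1 ⟨hα, hβ, by rwa [zPoint_update_two_pi]⟩

lemma Wj_const_ne_zero (hT : IsSolutionMap v lam j U t γ ξ x T) {r : ℝ}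
    (hr : r ∈ Icc (0 : ℝ) 1) {η : Fin d → ℝ} {θ : ℝ} (hθ : θ ∈ Ioo 0 (2 * Real.pi)) :
    Wj v lam j t (fun _ => r) (zPoint (v j) γ ξ t x (T r η).1 ((T r η).2 + θ) η) ≠ 0 := by
  intro h0
  obtain ⟨-, hβ, -⟩ := hT.isSolution_self hr η
  set α := toIcoMod Real.two_pi_pos 0 ((T r η).2 + θ)
  obtain ⟨m, hm⟩ : ∃ m : ℤ, (T r η).2 + θ = α + m * (2 * Real.pi) :=
    ⟨_, by rw [← zsmul_eq_mul]; exact (toIcoMod_add_toIcoDiv_zsmul _ _ _).symm⟩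
  rw [hm, zPoint_add_int_mul_two_pi] at h0
  have hαmem : α ∈ Ico 0 (2 * Real.pi) := by
    simpa only [zero_add] using toIcoMod_mem_Ico Real.two_pi_pos 0 ((T r η).2 + θ)
  have hαeq : α = (T r η).2 :=
    congrArg Prod.snd ((hT.isSolution_iff r hr η ((T r η).1, α)).1 ⟨hαmem, hβ, h0⟩)
  obtain rfl : θ = m * (2 * Real.pi) := by linarith
  have hm0 : (0 : ℝ) < m := pos_of_mul_pos_left hθ.1 Real.two_pi_pos.le
  have hm1 : (m : ℝ) < 1 := (mul_lt_iff_lt_one_left Real.two_pi_pos).1 hθ.2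
  norm_cast at hm0 hm1
  omega

lemma exists_apply_add_smul_eq (hT : IsSolutionMap v lam j U t γ ξ x T) (hρ : Continuous ρ)
    (hρI : ∀ y, ρ y ∈ Icc (0 : ℝ) 1) (η : Fin d → ℝ) :
    ∃ r ∈ Icc (0 : ℝ) 1, ρ (x + (T r η).1 • realVec (v j)) = r := by
  have hcont : ContinuousOn (fun r => T r η) (Icc 0 1) := fun r hr =>
    ((hT.contDiffAt r hr η).continuousAt.comp
      (f := fun r => (r, η)) (by fun_prop)).continuousWithinAt
  refine exists_mem_Icc_isFixedPt_of_mapsTo (f := fun r => ρ (x + (T r η).1 • realVec (v j)))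
    ?_ zero_le_one fun r _ => hρI _
  exact hρ.comp_continuousOn (continuousOn_const.add (hcont.fst.smul continuousOn_const))

/-- Each `η` gives a fixed point `r` of the value of `ρ` at the solution for the constant cut-off
`r`; all these solutions lie on `β_{x,amoeba}`, so the fixed point does not depend on `η`. -/
lemma exists_isSolution_iff (hT : IsSolutionMap v lam j U t γ ξ x T) (ht : Real.log t ≠ 0)
    (hρ : Continuous ρ) (hρI : ∀ y, ρ y ∈ Icc (0 : ℝ) 1)
    (hconst : ∀ y ∈ betaAmoeba v lam j U t ρ x, ∀ y' ∈ betaAmoeba v lam j U t ρ x, ρ y = ρ y') :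
    ∃ r ∈ Icc (0 : ℝ) 1, (∀ η, ρ (x + (T r η).1 • realVec (v j)) = r) ∧
      ∀ η s, IsSolution v lam j U t ρ γ ξ x η s ↔ s = T r η := by
  have hfix : ∀ r ∈ Icc (0 : ℝ) 1, ∀ η, ρ (x + (T r η).1 • realVec (v j)) = r →
      IsSolution v lam j U t ρ γ ξ x η (T r η) := fun r hr η h => by
    rw [isSolution_iff_const ht, h]
    exact hT.isSolution_self hr η
  obtain ⟨r, hr, hr0⟩ := hT.exists_apply_add_smul_eq hρ hρI 0
  have hval : ∀ η s, IsSolution v lam j U t ρ γ ξ x η s →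
      ρ (x + s.1 • realVec (v j)) = r := fun η s hs =>
    (hconst _ hs.2.1 _ (hfix r hr 0 hr0).2.1).trans hr0
  have hT_val : ∀ η, ρ (x + (T r η).1 • realVec (v j)) = r := fun η => by
    obtain ⟨r', hr', h'⟩ := hT.exists_apply_add_smul_eq hρ hρI η
    obtain rfl : r' = r := h'.symm.trans (hval η _ (hfix r' hr' η h'))
    exact h'
  refine ⟨r, hr, hT_val, fun η s => ⟨fun hs => ?_, ?_⟩⟩
  · have hsr := (isSolution_iff_const ht).1 hs
    rwa [hval η s hs, hT.isSolution_iff r hr] at hsr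
  · rintro rfl
    exact hfix r hr η (hT_val η)

end IsSolutionMap

end Solutions

/-! ### The singular fiber -/

section SingularFiber

variable {d p : ℕ} {v : Fin p → Fin (d + 1) → ℤ} {lam : Fin p → ℝ} {j : Fin p}
  {U : Set (Fin (d + 1) → ℝ)} {t : ℝ} {ρ : (Fin (d + 1) → ℝ) → ℝ} {γ : Fin (d + 1) → ℤ}
  {ξ : Matrix (Fin d) (Fin (d + 1)) ℤ} {x : Fin (d + 1) → ℝ}

lemma singularFiber_mem_simpleModel (s : Fin (d + 2) → ℝ) :
    singularFiber v lam j U t ρ γ ξ x s ∈ simpleModel v lam j t ρ :=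
  ⟨fun _ => Complex.exp_ne_zero _, hyperbolaPoint_fst_mul_snd⟩

/-- The parametrization of the singular fiber for the constant cut-off value `r`, with an arbitrary
map `T` in the place of `η ↦ (τ_x(η), α_x(η))`. -/
def solutionFiber {d p : ℕ} (v : Fin p → Fin (d + 1) → ℤ) (lam : Fin p → ℝ) (j : Fin p) (t : ℝ)
    (γ : Fin (d + 1) → ℤ) (ξ : Matrix (Fin d) (Fin (d + 1)) ℤ) (x : Fin (d + 1) → ℝ) (r : ℝ)
    (T : (Fin d → ℝ) → ℝ × ℝ) : (Fin (d + 2) → ℝ) → Ambient (d + 1) :=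
  torusFiberMap (Wj v lam j t fun _ => r)
    (fiberLog (v j) γ ξ t x (fun η => (T η).1) fun η => (T η).2)

lemma singularFiber_eq_solutionFiber (ht : Real.log t ≠ 0) {r : ℝ} {T : (Fin d → ℝ) → ℝ × ℝ}
    (hρ : ∀ η, ρ (x + (T η).1 • realVec (v j)) = r)
    (hT : ∀ η s, IsSolution v lam j U t ρ γ ξ x η s ↔ s = T η) :
    singularFiber v lam j U t ρ γ ξ x = solutionFiber v lam j t γ ξ x r T := by
  have hsol : solution v lam j U t ρ γ ξ x = T := funext fun η =>
    (hT η _).1 (Classical.epsilon_spec ⟨T η, (hT η _).2 rfl⟩)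
  funext s
  have hW := Wj_zPoint_eq_const (v := v) (lam := lam) (j := j) (ρ := ρ) (w := v j) (γ := γ)
    (ξ := ξ) (x := x) ht (T (etaProj d s)).1 ((T (etaProj d s)).2 + s 1) (etaProj d s)
  rw [hρ] at hW
  change (_, hyperbolaPoint (Wj v lam j t ρ (zPoint (v j) γ ξ t x
    (solution v lam j U t ρ γ ξ x (etaProj d s)).1
    ((solution v lam j U t ρ γ ξ x (etaProj d s)).2 + s 1) (etaProj d s))) (s 0)) = _
  rw [hsol, hW]
  rfl

namespace IsSolutionMap

variable {T : ℝ → (Fin d → ℝ) → ℝ × ℝ} {r : ℝ}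

lemma continuous_solutionFiber (hT : IsSolutionMap v lam j U t γ ξ x T)
    (hr : r ∈ Icc (0 : ℝ) 1) : Continuous (solutionFiber v lam j t γ ξ x r (T r)) :=
  continuous_torusFiberMap
    (fun _ hz => (differentiableAt_Wj_const v lam j t r hz).continuousAt.continuousWithinAt)
    (contDiff_fiberLog (hT.contDiff hr).fst (hT.contDiff hr).snd).continuous

lemma solutionFiber_update_two_pi (hT : IsSolutionMap v lam j U t γ ξ x T)
    (hr : r ∈ Icc (0 : ℝ) 1) (s : Fin (d + 2) → ℝ) (b : Fin (d + 2)) :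
    solutionFiber v lam j t γ ξ x r (T r) (Function.update s b (2 * Real.pi)) =
      solutionFiber v lam j t γ ξ x r (T r) (Function.update s b 0) :=
  torusFiberMap_update_two_pi (exp_fiberLog_update_two_pi
    (fun η k => congrArg Prod.fst (hT.update_two_pi hr η k))
    (fun η k => congrArg Prod.snd (hT.update_two_pi hr η k)) s b)

lemma ae_solutionFiber_ne_zero_and_differentiableAt (hT : IsSolutionMap v lam j U t γ ξ x T)
    (hr : r ∈ Icc (0 : ℝ) 1) :
    ∀ᵐ s ∂(volume.restrict (cube (d + 2))),
      (solutionFiber v lam j t γ ξ x r (T r) s).2.1 ≠ 0 ∧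
        DifferentiableAt ℝ (solutionFiber v lam j t γ ξ x r (T r)) s :=
  ae_restrict_cube_of_forall_mem_Ioo fun _ hs =>
    have hne := hT.Wj_const_ne_zero hr (hs 1)
    have hℓ := contDiff_fiberLog (hT.contDiff hr).fst (hT.contDiff hr).snd
    ⟨hyperbolaPoint_fst_ne_zero hne, differentiableAt_torusFiberMap
      (differentiableAt_Wj_const v lam j t r fun _ => Complex.exp_ne_zero _)
      (hℓ.differentiable one_ne_zero _) hne⟩

lemma integrableOn_pullbackOmega_solutionFiber (hT : IsSolutionMap v lam j U t γ ξ x T)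
    (hr : r ∈ Icc (0 : ℝ) 1) {N : ℝ} {e : Fin d → ℝ}
    (hv : realVec (v j) = N • realVec γ + e ᵥ* realMat ξ) :
    IntegrableOn (pullbackOmega (solutionFiber v lam j t γ ξ x r (T r))) (cube (d + 2)) :=
  integrableOn_pullbackOmega_torusFiberMap_fiberLog
    (fun _ hz => differentiableAt_Wj_const v lam j t r hz) (hT.contDiff hr).fst
    (hT.contDiff hr).snd (fun _ hs => hT.Wj_const_ne_zero hr hs) hv

lemma setIntegral_pullbackOmega_solutionFiber (hT : IsSolutionMap v lam j U t γ ξ x T)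
    (hr : r ∈ Icc (0 : ℝ) 1) {N : ℝ} {e : Fin d → ℝ}
    (hv : realVec (v j) = N • realVec γ + e ᵥ* realMat ξ) :
    ∫ s in cube (d + 2), pullbackOmega (solutionFiber v lam j t γ ξ x r (T r)) s =
      (2 * (Real.pi : ℂ) * Complex.I) ^ (d + 2) * (frame γ ξ).det :=
  setIntegral_pullbackOmega_torusFiberMap_fiberLog
    (fun _ hz => differentiableAt_Wj_const v lam j t r hz) (hT.contDiff hr).fst
    (hT.contDiff hr).snd (fun η k => congrArg Prod.fst (hT.update_two_pi hr η k))
    (fun _ hs => hT.Wj_const_ne_zero hr hs) hv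

end IsSolutionMap

lemma orientationSign_mul_det_frame_eq_edgeWeight {w : Fin (d + 1) → ℤ}
    {f : Fin d → TropPoly (d + 1)} {a : Fin (d + 1) → ℝ}
    (hcell : ∀ k, ∃ q, (f k).dualCell a = segment ℝ (realVec q) (realVec (q + ξ k)))
    (hγ : γ ⬝ᵥ w = 1) (hind : LinearIndependent ℝ (realMat ξ).row) (hperp : ξ *ᵥ w = 0) :
    (orientationSign w ξ : ℂ) * (frame γ ξ).det = (edgeWeight f a : ℂ) := by
  rw [edgeWeight_eq_abs_det hcell hγ hind hperp, ← Int.cast_abs, Complex.ofReal_intCast,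
    ← orientationSign_mul_det_frame hγ hind hperp, Int.cast_mul]

end SingularFiber

lemma FacetNeighborhoods.exists_pos_le_chi {n p : ℕ} {v : Fin p → Fin n → ℤ} {lam : Fin p → ℝ}
    {j : Fin p} (N : FacetNeighborhoods v lam j) {a : Fin n → ℝ} (ha : a ∈ N.U ∩ facet v lam j) :
    ∃ c : ℝ, 0 < c ∧ ∀ y ∈ N.U, ∀ k, k ≠ j → c ≤ chi v lam k y := by
  obtain ⟨c, hc, hU⟩ := N.gap
  exact ⟨c j, ha.2.2 ▸ (hU a ha.1).1, fun y hy k hk => ((hc k hk).trans ((hU y hy).2 k hk)).le⟩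

end TropicalPeriod

end

open TropicalPeriod in
theorem mainTheorem3_general {d p : ℕ} (v : Fin p → Fin (d + 1) → ℤ) (lam : Fin p → ℝ)
    (j : Fin p) (U : Set (Fin (d + 1) → ℝ))
    (hU : ∃ c : ℝ, 0 < c ∧ ∀ y ∈ U, ∀ k, k ≠ j → c ≤ chi v lam k y)
    (f : Fin d → TropPoly (d + 1)) (a : Fin (d + 1) → ℝ) (ξ : Fin d → Fin (d + 1) → ℤ)
    (hcell : ∀ k, ∃ q : Fin (d + 1) → ℤ,
      (f k).dualCell a = segment ℝ (realVec q) (realVec (q + ξ k)))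
    (hind : LinearIndependent ℝ fun k => realVec (ξ k)) (hperp : ∀ k, ∑ i, v j i * ξ k i = 0)
    (γ : Fin (d + 1) → ℤ) (hγ : ∑ i, γ i * v j i = 1)
    (K : Set (Fin (d + 1) → ℝ)) (hK : ∀ x ∈ K, chi v lam j x = 0)
    (hKU : ∃ δ : ℝ, 0 < δ ∧ ∀ x ∈ K, ∀ r : ℝ, |r| < δ → x + r • realVec (v j) ∈ U) :
    ∃ t₀ : ℝ, 0 < t₀ ∧ ∀ t : ℝ, 0 < t → t < t₀ →
      ∀ ρ : (Fin (d + 1) → ℝ) → ℝ, Continuous ρ → (∀ y, ρ y ∈ Icc (0 : ℝ) 1) →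
        ∀ x ∈ K, (∀ y ∈ betaAmoeba v lam j U t ρ x, ∀ y' ∈ betaAmoeba v lam j U t ρ x,
          ρ y = ρ y') →
        (∀ η : Fin d → ℝ, ∃! s : ℝ × ℝ, IsSolution v lam j U t ρ γ ξ x η s) ∧
        MapsTo (singularFiber v lam j U t ρ γ ξ x) (cube (d + 2)) (simpleModel v lam j t ρ) ∧
        ContinuousOn (singularFiber v lam j U t ρ γ ξ x) (cube (d + 2)) ∧
        (∀ s ∈ cube (d + 2), ∀ b : Fin (d + 2),
          singularFiber v lam j U t ρ γ ξ x (Function.update s b 0) =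
            singularFiber v lam j U t ρ γ ξ x (Function.update s b (2 * Real.pi))) ∧
        (∀ᵐ s ∂(volume.restrict (cube (d + 2))),
          (singularFiber v lam j U t ρ γ ξ x s).2.1 ≠ 0 ∧
            DifferentiableAt ℝ (singularFiber v lam j U t ρ γ ξ x) s) ∧
        IntegrableOn (pullbackOmega (singularFiber v lam j U t ρ γ ξ x)) (cube (d + 2)) ∧
        integralOnSingularFiber v lam j U t ρ γ ξ x =
          (2 * (Real.pi : ℂ) * Complex.I) ^ (d + 2) * (edgeWeight f a : ℂ) := by
  obtain ⟨c, hc, hcU⟩ := hU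
  obtain ⟨δ, hδ, hKU⟩ := hKU
  have hξ : Matrix.mulVec ξ (v j) = 0 := funext fun k => (dotProduct_comm _ _).trans (hperp k)
  obtain ⟨e, hv⟩ := exists_eq_dotProduct_smul_add_vecMul_realMat hγ hind hξ (v j)
  obtain ⟨t₀, ht₀, hsmall⟩ := mem_nhdsGT_iff_exists_Ioo_subset.1 <|
    Filter.inter_mem (Ioo_mem_nhdsGT one_pos)
      (eventually_exists_isSolutionMap hγ hξ hc hcU hK hδ hKU)
  refine ⟨t₀, ht₀, fun t ht htt₀ ρ hρ hρI x hx hconst => ?_⟩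
  obtain ⟨⟨-, ht1⟩, hex⟩ := hsmall ⟨ht, htt₀⟩
  obtain ⟨T, hT⟩ := hex x hx
  have hlog := (Real.log_neg ht ht1).ne
  obtain ⟨r, hr, hval, hsol⟩ := hT.exists_isSolution_iff hlog hρ hρI hconst
  refine ⟨fun η => ⟨T r η, (hsol η _).2 rfl, fun s => (hsol η s).1⟩,
    fun s _ => singularFiber_mem_simpleModel s, ?_⟩
  rw [integralOnSingularFiber, singularFiber_eq_solutionFiber hlog hval hsol]
  refine ⟨(hT.continuous_solutionFiber hr).continuousOn,
    fun s _ b => (hT.solutionFiber_update_two_pi hr s b).symm,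
    hT.ae_solutionFiber_ne_zero_and_differentiableAt hr,
    hT.integrableOn_pullbackOmega_solutionFiber hr hv, ?_⟩
  rw [hT.setIntegral_pullbackOmega_solutionFiber hr hv, mul_left_comm,
    orientationSign_mul_det_frame_eq_edgeWeight hcell hγ hind hξ]

open TropicalPeriod in
theorem mainTheorem3 {d p : ℕ} (v : Fin p → Fin (d + 1) → ℤ) (lam : Fin p → ℝ) (j : Fin p)
    (N : FacetNeighborhoods v lam j)
    (f : Fin d → TropPoly (d + 1)) (a : Fin (d + 1) → ℝ) (ξ : Fin d → Fin (d + 1) → ℤ)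
    (haU : a ∈ N.U) (he : IsEdgeEnd v lam j f a ξ)
    (γ : Fin (d + 1) → ℤ) (hγ : ∑ i, γ i * v j i = 1)
    (K : Set (Fin (d + 1) → ℝ)) (hK : K ⊆ N.U ∩ facet v lam j)
    (hKU : ∃ δ : ℝ, 0 < δ ∧ ∀ x ∈ K, ∀ r : ℝ, |r| < δ → x + r • realVec (v j) ∈ N.U) :
    ∃ t₀ : ℝ, 0 < t₀ ∧ ∀ t : ℝ, 0 < t → t < t₀ →
      ∀ ρ : (Fin (d + 1) → ℝ) → ℝ, IsCutoff N t ρ → ∀ x ∈ K,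
        (∀ η : Fin d → ℝ, ∃! s : ℝ × ℝ, IsSolution v lam j N.U t ρ γ ξ x η s) ∧
        Set.MapsTo (singularFiber v lam j N.U t ρ γ ξ x) (cube (d + 2))
          (simpleModel v lam j t ρ) ∧
        ContinuousOn (singularFiber v lam j N.U t ρ γ ξ x) (cube (d + 2)) ∧
        (∀ s ∈ cube (d + 2), ∀ b : Fin (d + 2),
          singularFiber v lam j N.U t ρ γ ξ x (Function.update s b 0) =
            singularFiber v lam j N.U t ρ γ ξ x (Function.update s b (2 * Real.pi))) ∧
        (∀ᵐ s ∂(MeasureTheory.volume.restrict (cube (d + 2))),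
          (singularFiber v lam j N.U t ρ γ ξ x s).2.1 ≠ 0 ∧
            DifferentiableAt ℝ (singularFiber v lam j N.U t ρ γ ξ x) s) ∧
        MeasureTheory.IntegrableOn (pullbackOmega (singularFiber v lam j N.U t ρ γ ξ x))
          (cube (d + 2)) ∧
        integralOnSingularFiber v lam j N.U t ρ γ ξ x =
          (2 * (Real.pi : ℂ) * Complex.I) ^ (d + 2) * (edgeWeight f a : ℂ) := by
  obtain ⟨t₀, ht₀, h⟩ := mainTheorem3_general v lam j N.U (N.exists_pos_le_chi ⟨haU, he.mem_facet⟩)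
    f a ξ he.cell he.indep he.perp γ hγ K (fun x hx => (hK hx).2.2) hKU
  exact ⟨t₀, ht₀, fun t ht htt₀ ρ hρ x hx =>
    h t ht htt₀ ρ hρ.smooth.continuous hρ.mem_Icc x hx (hρ.const_on x (hK hx))⟩
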